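/- Let $\Sigma$ be a Riemann surface and $D=\sum_i(\theta_i-1)p_i$ a real divisor on $\Sigma$ with $0\le\theta_i\ne 1$, whose support $\{p_i\}$ is a closed discrete set. Let $d\sigma^2$ be a singular conformal hyperbolic metric representing $D$. This means that $d\sigma^2$ is a $C^\infty$ conformal metric of constant curvature $-1$ on $\Sigma\setminus\operatorname{supp}D$ and, for each $i$, there is a complex coordinate $z$ near $p_i$ with $z(p_i)=0$ such that, writing $d\sigma^2=e^{2u}|dz|^2$ off $p_i$, the following function extends continuously to $p_i$: $u-(\theta_i-1)\ln|z|$ if $\theta_i>0$ (a conical singularity with cone angle $2\pi\theta_i$), and $u+\ln|z|+\ln(-\ln|z|)$ if $\theta_i=0$ (a cusp singularity). A developing map of $d\sigma^2$ with values in $\Omega$, where $\Omega$ is the unit disc $\mathbb D$ with the metric $\frac{4|dw|^2}{(1-|w|^2)^2}$ or the upper half-plane $\mathbb H$ with the metric $\frac{|dw|^2}{(\operatorname{Im}w)^2}$, is a multi-valued, locally univalent holomorphic function $F$ on $\Sigma\setminus\operatorname{supp}D$ (a function on the universal cover) with values in $\Omega$, such that any two function elements of $F$ near a point are related by an element of $\mathrm{PGL}(2,\mathbb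 C)$ and the metric of $\Omega$ is pulled back by $F$ to $d\sigma^2$. Let $$\mathrm{PSU}(1,1)=\Big\{w\mapsto\frac{aw+b}{\bar b w+\bar a}:\ a,b\in\mathbb C,\ |a|^2-|b|^2=1\Big\},\qquad \mathrm{PSL}(2,\mathbb R)=\Big\{w\mapsto\frac{aw+b}{cw+d}:\ a,b,c,d\in\mathbb R,\ ad-bc=1\Big\}.$$ (1) Let $F$ be a developing map of $d\sigma^2$ with values in $\mathbb D$, and let $p$ be a conical singularity of $d\sigma^2$ with cone angle $2\pi\alpha>0$. Then there is a neighbourhood $U$ of $p$ with $U\cap\operatorname{supp}D=\{p\}$ and a complex coordinate $z$ on $U$, mapping $U$ onto a disc centred at $0$ with $z(p)=0$, such that for every branch of $F$ over $U\setminus\{p\}$, continued along all paths in $U\setminus\{p\}$, there is $\mathfrak L\in\mathrm{PSU}(1,1)$ with $$\mathfrak L\circ F=z^{\alpha}.$$ (2) Let $F$ be a developing map of $d\sigma^2$ with values in $\mathbb H$, and let $q$ be a cusp singularity of $d\sigma^2$. Then there is a neighbourhood $V$ of $q$ with $V\cap\operatorname{supp}D=\{q\}$ and a complex coordinate $z$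 on $V$, mapping $V$ onto a disc centred at $0$ with $z(q)=0$, such that for every branch of $F$ over $V\setminus\{q\}$, continued along all paths in $V\setminus\{q\}$, there is $\mathfrak L\in\mathrm{PSL}(2,\mathbb R)$ with $$\mathfrak L\circ F=-\sqrt{-1}\,\log z.$$ Both equalities are equalities of multi-valued functions on the punctured neighbourhood, expressed through $w=\log z$: the continued branch, composed with $\mathfrak L$, is $w\mapsto e^{\alpha w}$, respectively $w\mapsto-\sqrt{-1}\,w$. -/

import Mathlib

open Set Filter Topology
open scoped Manifold ContDiff

noncomputable section

/-- The complex coordinates of a Riemann surface `X`: all charts `z : U → ℂ` of the maximal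
holomorphic atlas. -/
def coordinates (X : Type*) [TopologicalSpace X] [ChartedSpace ℂ X] :
    Set (OpenPartialHomeomorph X ℂ) :=
  IsManifold.maximalAtlas 𝓘(ℂ) ω X

/-- A `C^∞` conformal metric on the open subset `W` of a Riemann surface `X`. In the complex
coordinate `e` it reads `(density e z)² |dz|²`; the values of `density e` matter only at the points
of the coordinate domain that lie in `W`. -/
structure ConformalMetric {X : Type*} [TopologicalSpace X] [ChartedSpace ℂ X] (W : Set X) where
  density : OpenPartialHomeomorph X ℂ → ℂ → ℝ
  density_pos : ∀ e ∈ coordinates X, ∀ x ∈ e.source ∩ W, 0 < density e (e x)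
  density_smooth : ∀ e ∈ coordinates X, ContDiffOn ℝ ∞ (density e) (e '' (e.source ∩ W))
  /-- change of coordinates: `ρ |dz| = ρ' |dz'|` -/
  density_change : ∀ e ∈ coordinates X, ∀ e' ∈ coordinates X, ∀ x ∈ e.source ∩ e'.source ∩ W,
    density e (e x) = density e' (e' x) * ‖deriv (e' ∘ e.symm) (e x)‖

/-- The Gaussian curvature at `z` of the metric `ρ² |dz|²` on a plane domain. -/
def gaussCurvature (ρ : ℂ → ℝ) (z : ℂ) : ℝ :=
  -Laplacian.laplacian (fun w : ℂ => Real.log (ρ w)) z / ρ z ^ 2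

section Metric

variable {X : Type*} [TopologicalSpace X] [ChartedSpace ℂ X] {W : Set X}

/-- The metric has constant curvature `-1`. -/
def ConformalMetric.IsHyperbolic (m : ConformalMetric W) : Prop :=
  ∀ e ∈ coordinates X, ∀ x ∈ e.source ∩ W, gaussCurvature (m.density e) (e x) = -1

/-- `m` has a conical singularity at `p` with cone angle `2πθ > 0`: in some coordinate `z` centred
at `p`, whose domain contains no other singular point, `m = e^{2u}|dz|²` on the punctured domain
where `u - (θ - 1) log |z|` extends to a continuous function. -/
def ConformalMetric.HasConicalSingularity (m : ConformalMetric W) (p : X) (θ : ℝ) : Prop :=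
  0 < θ ∧ ∃ e ∈ coordinates X, p ∈ e.source ∧ e p = 0 ∧ e.source \ {p} ⊆ W ∧
    ∃ c : ℂ → ℝ, ContinuousOn c e.target ∧ ∀ z ∈ e.target \ {0},
      Real.log (m.density e z) - (θ - 1) * Real.log ‖z‖ = c z

/-- `m` has a cusp singularity at `p`: in some coordinate `z` centred at `p`, with `|z| < 1`, whose
domain contains no other singular point, `m = e^{2u}|dz|²` on the punctured domain where
`u + log |z| + log (-log |z|)` extends to a continuous function. -/
def ConformalMetric.HasCuspSingularity (m : ConformalMetric W) (p : X) : Prop :=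
  ∃ e ∈ coordinates X, p ∈ e.source ∧ e p = 0 ∧ e.source \ {p} ⊆ W ∧
    e.target ⊆ Metric.ball 0 1 ∧
    ∃ c : ℂ → ℝ, ContinuousOn c e.target ∧ ∀ z ∈ e.target \ {0},
      Real.log (m.density e z) + Real.log ‖z‖ + Real.log (-Real.log ‖z‖) = c z

/-- `m` is a singular conformal hyperbolic metric representing the real divisor
`D = ∑ (θᵢ - 1) pᵢ` with `0 ≤ θᵢ ≠ 1`. So `D p = θ - 1` at the points of the (closed and discrete)
support, and `m` is a metric on the complement of the support. -/
def ConformalMetric.Represents (D : Function.locallyFinsupp X ℝ)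
    (m : ConformalMetric (D.support)ᶜ) : Prop :=
  m.IsHyperbolic ∧ ∀ p ∈ D.support, 0 ≤ D p + 1 ∧
    (0 < D p + 1 → m.HasConicalSingularity p (D p + 1)) ∧
    (D p + 1 = 0 → m.HasCuspSingularity p)

variable {E : Type*} [TopologicalSpace E]

/-- `π : E → X` is a universal covering of the subset `W` of `X`. -/
structure IsUniversalCovering (W : Set X) (π : E → X) : Prop where
  simplyConnected : SimplyConnectedSpace E
  range_eq : Set.range π = W
  isCoveringMapOn : IsCoveringMapOn π W

/-- `s` is a continuous local section over `V` of the covering `π`, written in the coordinate `e`.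
If a multi-valued function is given as a single-valued function `F` on the covering space, then
`F ∘ s` is one of its function elements, written in the coordinate `e`. -/
def IsLocalSection (π : E → X) (e : OpenPartialHomeomorph X ℂ) (V : Set ℂ) (s : ℂ → E) : Prop :=
  IsOpen V ∧ V ⊆ e.target ∧ ContinuousOn s V ∧ ∀ z ∈ V, π (s z) = e.symm z

/-- The multi-valued function on `W` given by `F : E → ℂ` on a covering `π : E → X` of `W` is a
locally univalent holomorphic function, and any two of its function elements near a point are
related by a fractional linear transformation in `PGL(2, ℂ)` (acting on `ℂ ∪ {∞}`). -/
structure IsProjective (π : E → X) (F : E → ℂ) : Prop where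
  holomorphic : ∀ e ∈ coordinates X, ∀ V s, IsLocalSection π e V s →
    DifferentiableOn ℂ (F ∘ s) V
  locallyUnivalent : ∀ e ∈ coordinates X, ∀ V s, IsLocalSection π e V s →
    ∀ z ∈ V, ∃ N ∈ 𝓝 z, InjOn (F ∘ s) N
  projective : ∀ x₁ x₂ : E, π x₁ = π x₂ → ∃ M : GL (Fin 2) ℂ,
    ∀ᶠ y in 𝓝 x₁ ×ˢ 𝓝 x₂, π y.1 = π y.2 → (F y.1 : OnePoint ℂ) = M • (F y.2 : OnePoint ℂ)

/-- `F`, a function on the universal cover of `W`, is a developing map of the metric `m` on `W`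
with values in the model `(Ω, ρ² |dw|²)` of the hyperbolic plane: a projective function that pulls
the model metric back to `m`. -/
structure IsDevelopingMap (m : ConformalMetric W) (π : E → X) (Ω : Set ℂ) (ρ : ℂ → ℝ)
    (F : E → ℂ) : Prop where
  mapsTo : ∀ x, F x ∈ Ω
  isProjective : IsProjective π F
  pullback : ∀ e ∈ coordinates X, ∀ V s, IsLocalSection π e V s →
    ∀ z ∈ V, m.density e z = ρ (F (s z)) * ‖deriv (F ∘ s) z‖

end Metric

/-- The unit disc with the metric `4 |dz|² / (1 - |z|²)²`. -/
def disc : Set ℂ := Metric.ball 0 1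

def discDensity (z : ℂ) : ℝ := 2 / (1 - ‖z‖ ^ 2)

/-- The upper half-plane with the metric `|dz|² / (Im z)²`. -/
def halfPlane : Set ℂ := {z | 0 < z.im}

def halfPlaneDensity (z : ℂ) : ℝ := 1 / z.im

/-- The transformations in `PSU(1,1)`, to be applied to points of the unit disc. -/
def PSU11 : Set (ℂ → ℂ) :=
  {L | ∃ a b : ℂ, ‖a‖ ^ 2 - ‖b‖ ^ 2 = 1 ∧
    L = fun z : ℂ => (a * z + b) / (starRingEnd ℂ b * z + starRingEnd ℂ a)}

/-- The transformations in `PSL(2,ℝ)`, to be applied to points of the upper half-plane. -/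
def PSL2R : Set (ℂ → ℂ) :=
  {L | ∃ a b c d : ℝ, a * d - b * c = 1 ∧ L = fun z : ℂ => (a * z + b) / (c * z + d)}

/-- Let `e` be a coordinate `z` centred at `p` whose image is the disc of radius `r`, and let `F` be
a multi-valued function, given on a covering `π : E → X`, whose values lie in the model on which the
group `Γ` acts. This says that, over the punctured disc, `L ∘ F` is the multi-valued function
`g (log z)`, with `L ∈ Γ`. Precisely: the punctured disc is uniformized by
`{w | Re w < log r}` through `z = exp w`, so `w = log z`. For any point `x₀` of the covering space
over the punctured disc, i.e. for any choice of a branch of `F`, and any value `w₀` of `log z` there,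
the branch is continued by a lift `φ` of this uniformization with `φ w₀ = x₀`, and
`L (F (φ w)) = g w` for some `L ∈ Γ` and all `w`. -/
def HasLocalForm {X E : Type*} [TopologicalSpace X] [TopologicalSpace E] (π : E → X) (F : E → ℂ)
    (Γ : Set (ℂ → ℂ)) (e : OpenPartialHomeomorph X ℂ) (r : ℝ) (g : ℂ → ℂ) : Prop :=
  ∀ (x₀ : E) (w₀ : ℂ), w₀.re < Real.log r → π x₀ = e.symm (Complex.exp w₀) →
    ∃ φ : ℂ → E, ContinuousOn φ {w | w.re < Real.log r} ∧ φ w₀ = x₀ ∧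
      (∀ w : ℂ, w.re < Real.log r → π (φ w) = e.symm (Complex.exp w)) ∧
      ∃ L ∈ Γ, ∀ w : ℂ, w.re < Real.log r → L (F (φ w)) = g w

end

/-!
Everything happens in the logarithmic coordinate `w = log z` of a punctured disc `0 < |z| < r`
centred at the singularity. The half-plane `{Re w < log r}` is simply connected, so any branch of
the developing map lifts there to a holomorphic function `f`, which is a local isometry for the
metric pulled back by `z = exp w` (`IsUniversalCovering.exists_lift`,
`IsDevelopingMap.isLocalIsometry`).

The proof rests on rigidity: two local isometries from a connected plane domain into the hyperbolic
plane that pull back the same metric differ by an isometry in `PSU(1,1)`, respectively `PSL(2,ℝ)`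
(`disc_rigidity`, `halfPlane_rigidity`). After normalization both vanish at a common point, and
locally one is the other followed by a local isometry fixing the centre of the disc; such a map
cannot outrun the identity along radii, and its derivative at the centre has modulus one, so it is a
rotation by the equality case of the Schwarz lemma. Rigidity is used twice.

First, the pulled back metric is invariant under `w ↦ w + 2πi`, so `f (w + 2πi) = T (f w)` with `T`
in `PSL(2,ℝ)`. The circles around the puncture become arbitrarily short, which rules out a
hyperbolic `T` (`not_hyperbolic_monodromy`). If `T` is elliptic or trivial, then in the disc model
`f = z ^ γ G(z)` with `G(0) ≠ 0` by the removable singularity theorem, so `f` is the `γ`-th power of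
a coordinate (`exists_isLocallyModelledOn_cone_of_rotation`). If `T` is parabolic, it can be
normalized to `f (w + 2πi) = f w ± 2π`, and `exp (i f)` is a bounded holomorphic function of `z`;
the sign is its order of vanishing at the puncture, so it is `+` and `exp (i f)` is a coordinate
(`isLocallyModelledOn_cusp_of_translation`). So in a suitable coordinate the metric is a model cone
or a model cusp (`isLocallyModelledOn_cone_or_cusp`). The growth of the density at the puncture
identifies which one, and the angle (`HasConeGrowth.le`, `HasConeGrowth.not_hasCuspGrowth`).

Second, once the metric is the model one in the coordinate `z`, every branch of the developing map
over the punctured disc pulls back the same metric as `exp (α w)`, respectively `-i w`, and so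
differs from it by an isometry of the model (`hasLocalForm_of_density`).
-/

/-! ### Local isometries between plane domains -/

/-- `f` is a holomorphic local isometry from the plane domain `U` with the conformal metric
`σ² |dw|²` to the plane domain `Ω` with the conformal metric `ρ² |dw|²`. -/
def IsLocalIsometry (U : Set ℂ) (σ : ℂ → ℝ) (Ω : Set ℂ) (ρ : ℂ → ℝ) (f : ℂ → ℂ) : Prop :=
  ∀ w ∈ U, f w ∈ Ω ∧ DifferentiableAt ℂ f w ∧ ρ (f w) * ‖deriv f w‖ = σ w

namespace IsLocalIsometry

variable {U V Ω : Set ℂ} {σ τ ρ : ℂ → ℝ} {f g : ℂ → ℂ}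

theorem comp (hg : IsLocalIsometry V τ Ω ρ g) (hf : IsLocalIsometry U σ V τ f) :
    IsLocalIsometry U σ Ω ρ (g ∘ f) := by
  intro w hw
  obtain ⟨h1, h2, h3⟩ := hf w hw
  obtain ⟨k1, k2, k3⟩ := hg _ h1
  refine ⟨k1, k2.comp w h2, ?_⟩
  rw [deriv_comp w k2 h2, norm_mul, ← h3, ← k3, Function.comp_apply, mul_assoc]

theorem mono (hf : IsLocalIsometry U σ Ω ρ f) (h : V ⊆ U) : IsLocalIsometry V σ Ω ρ f :=
  fun w hw => hf w (h hw)

theorem differentiableOn (hf : IsLocalIsometry U σ Ω ρ f) : DifferentiableOn ℂ f U :=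
  fun w hw => (hf w hw).2.1.differentiableWithinAt

theorem deriv_ne_zero (hf : IsLocalIsometry U σ Ω ρ f) {w : ℂ} (hw : w ∈ U) (h : 0 < σ w) :
    deriv f w ≠ 0 := by
  intro h0
  have := (hf w hw).2.2
  simp [h0] at this
  linarith

end IsLocalIsometry

theorem exists_openPartialHomeomorph_of_deriv_ne_zero {ψ : ℂ → ℂ} {z₀ : ℂ} {N : Set ℂ}
    (hψ : AnalyticAt ℂ ψ z₀) (h' : deriv ψ z₀ ≠ 0) (hN : N ∈ 𝓝 z₀) :
    ∃ Ψ : OpenPartialHomeomorph ℂ ℂ, (Ψ : ℂ → ℂ) = ψ ∧ z₀ ∈ Ψ.source ∧ Ψ.source ⊆ N ∧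
      (∀ z ∈ Ψ.source, AnalyticAt ℂ ψ z ∧ deriv ψ z ≠ 0) ∧
      ∀ ζ ∈ Ψ.target, AnalyticAt ℂ Ψ.symm ζ := by
  have h2 : ∀ᶠ z in 𝓝 z₀, z ∈ N ∧ AnalyticAt ℂ ψ z ∧ deriv ψ z ≠ 0 :=
    (eventually_mem_set.2 hN).and (hψ.eventually_analyticAt.and
      (hψ.deriv.continuousAt.eventually_ne h'))
  obtain ⟨S, hS, hSo, hzS⟩ := eventually_nhds_iff.1 h2
  have hfd : HasStrictFDerivAt ψ
      (ContinuousLinearEquiv.unitsEquivAut ℂ (.mk0 _ h')).toContinuousLinearMap z₀ :=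
    hψ.hasStrictDerivAt
  let R : OpenPartialHomeomorph ℂ ℂ := hfd.toOpenPartialHomeomorph _
  have hR : (R : ℂ → ℂ) = ψ := rfl
  have hzR : z₀ ∈ R.source := HasStrictFDerivAt.mem_toOpenPartialHomeomorph_source _
  have hsrc : (R.restrOpen S hSo).source = R.source ∩ S := R.restrOpen_source S hSo
  refine ⟨R.restrOpen S hSo, rfl, ?_, ?_, ?_, ?_⟩
  · rw [hsrc]; exact ⟨hzR, hzS⟩
  · rw [hsrc]; exact fun z hz => (hS z hz.2).1
  · rw [hsrc]; exact fun z hz => (hS z hz.2).2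
  · intro ζ hζ
    have hm := (R.restrOpen S hSo).map_target hζ
    rw [hsrc] at hm
    obtain ⟨_, ha, hd⟩ := hS _ hm.2
    exact ContDiffAt.analyticAt ((R.restrOpen S hSo).contDiffAt_symm_deriv hd hζ
      ha.differentiableAt.hasDerivAt ha.contDiffAt)

theorem isOpen_disc : IsOpen disc := Metric.isOpen_ball

theorem mem_disc {z : ℂ} : z ∈ disc ↔ ‖z‖ < 1 := by simp [disc]

/-! ### Rigidity of local isometries into the hyperbolic plane -/

/-- Along a radius, a local isometry of the disc fixing the centre cannot outrun the identity: the
comparison function `(1 + ε) t ‖z‖` is a strict upper barrier for `‖h (t z)‖`. -/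
theorem norm_le_norm_of_discIsometry {h : ℂ → ℂ} {δ : ℝ} (hδ : δ ≤ 1)
    (hh : IsLocalIsometry (Metric.ball 0 δ) discDensity disc discDensity h) (h0 : h 0 = 0)
    {z : ℂ} (hz : z ∈ Metric.ball (0 : ℂ) δ) : ‖h z‖ ≤ ‖z‖ := by
  rcases eq_or_ne z 0 with rfl | hz0
  · simp [h0]
  have hzn : 0 < ‖z‖ := norm_pos_iff.2 hz0
  have hzδ : ‖z‖ < δ := by simpa using hz
  have hmem : ∀ t ∈ Icc (0 : ℝ) 1, (t : ℂ) * z ∈ Metric.ball (0 : ℂ) δ := by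
    intro t ht
    simp only [mem_ball_zero_iff, norm_mul, Complex.norm_real, Real.norm_of_nonneg ht.1]
    nlinarith [ht.2]
  have key : ∀ ε > 0, ‖h z‖ ≤ (1 + ε) * ‖z‖ := by
    intro ε hε
    have hder : ∀ t ∈ Icc (0 : ℝ) 1,
        HasDerivAt (fun t : ℝ => h (t * z)) (deriv h (t * z) * z) t := by
      intro t ht
      have h1 := (hh _ (hmem t ht)).2.1.hasDerivAt
      have h2 : HasDerivAt (fun t : ℂ => t * z) z (t : ℂ) := by
        simpa using (hasDerivAt_id (t : ℂ)).mul_const z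
      exact (h1.comp (t : ℂ) h2).comp_ofReal
    have hB : ∀ t : ℝ, HasDerivAt (fun t : ℝ => (1 + ε) * ‖z‖ * t) ((1 + ε) * ‖z‖) t := by
      intro t
      simpa using (hasDerivAt_id t).const_mul ((1 + ε) * ‖z‖)
    have := image_norm_le_of_norm_deriv_right_lt_deriv_boundary (a := (0 : ℝ)) (b := 1)
      (f := fun t : ℝ => h (t * z)) (f' := fun t => deriv h (t * z) * z)
      (fun t ht => (hder t ht).continuousAt.continuousWithinAt)
      (fun t ht => (hder t (Ico_subset_Icc_self ht)).hasDerivWithinAt)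
      (B := fun t => (1 + ε) * ‖z‖ * t) (B' := fun _ => (1 + ε) * ‖z‖)
      (by simp [h0]) hB ?_ (right_mem_Icc.2 zero_le_one)
    · simpa using this
    · intro t ht hBt
      obtain ⟨m1, -, m3⟩ := hh _ (hmem t (Ico_subset_Icc_self ht))
      rw [mem_disc] at m1
      have hn : ‖(t : ℂ) * z‖ = t * ‖z‖ := by
        rw [norm_mul, Complex.norm_real, Real.norm_of_nonneg ht.1]
      have hle : ‖(t : ℂ) * z‖ ≤ ‖h (t * z)‖ := by
        rw [hn, hBt]; nlinarith [mul_nonneg (mul_nonneg hε.le hzn.le) ht.1]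
      have hlt : ‖(t : ℂ) * z‖ < 1 := lt_of_le_of_lt hle m1
      have hp1 : 0 < 1 - ‖h (t * z)‖ ^ 2 := by nlinarith [norm_nonneg (h (t * z))]
      have hp2 : 1 - ‖h (t * z)‖ ^ 2 ≤ 1 - ‖(t : ℂ) * z‖ ^ 2 := by
        nlinarith [norm_nonneg ((t : ℂ) * z)]
      have hp3 : 0 < 1 - ‖(t : ℂ) * z‖ ^ 2 := hp1.trans_le hp2
      have hd : ‖deriv h (t * z)‖ ≤ 1 := by
        unfold discDensity at m3
        rw [div_mul_eq_mul_div, div_eq_div_iff hp1.ne' hp3.ne'] at m3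
        by_contra! hcon
        nlinarith
      rw [norm_mul]
      nlinarith
  refine le_of_forall_pos_le_add fun ε hε => ?_
  have := key (ε / ‖z‖) (by positivity)
  rwa [add_mul, one_mul, div_mul_cancel₀ _ hzn.ne'] at this

/-- Two local isometries into the disc that vanish at a common point differ by a rotation: locally
one is the other followed by an isometry fixing the centre, which is linear by the equality case of
the Schwarz lemma. -/
theorem eq_rotation_of_isLocalIsometry {U : Set ℂ} {σ : ℂ → ℝ} {f g : ℂ → ℂ} (hU : IsOpen U)
    (hUc : IsPreconnected U) (hσ : ∀ w ∈ U, 0 < σ w) (hf : IsLocalIsometry U σ disc discDensity f)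
    (hg : IsLocalIsometry U σ disc discDensity g) {w₀ : ℂ} (hw₀ : w₀ ∈ U) (hf0 : f w₀ = 0)
    (hg0 : g w₀ = 0) : ∃ c : ℂ, ‖c‖ = 1 ∧ ∀ w ∈ U, g w = c * f w := by
  have hfa : AnalyticOnNhd ℂ f U := hf.differentiableOn.analyticOnNhd hU
  have hga : AnalyticOnNhd ℂ g U := hg.differentiableOn.analyticOnNhd hU
  obtain ⟨Φ, hΦ, hΦ0, hΦU, hΦd, hΦs⟩ := exists_openPartialHomeomorph_of_deriv_ne_zero (hfa w₀ hw₀)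
    (hf.deriv_ne_zero hw₀ (hσ _ hw₀)) (hU.mem_nhds hw₀)
  have h0t : (0 : ℂ) ∈ Φ.target := by
    have := Φ.map_source hΦ0
    rwa [hΦ, hf0] at this
  have hs0 : Φ.symm 0 = w₀ := by
    have := Φ.left_inv hΦ0
    rwa [hΦ, hf0] at this
  obtain ⟨δ', hδ', hball'⟩ := Metric.isOpen_iff.1 Φ.open_target 0 h0t
  set δ := min δ' 1 with hδ
  have hδ0 : 0 < δ := lt_min hδ' one_pos
  have hball : Metric.ball (0 : ℂ) δ ⊆ Φ.target :=
    (Metric.ball_subset_ball (min_le_left _ _)).trans hball'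
  have hsymm : IsLocalIsometry (Metric.ball 0 δ) discDensity U σ Φ.symm := by
    intro ζ hζ
    have hm := Φ.map_target (hball hζ)
    have hU' := hΦU hm
    have hd := (hΦs ζ (hball hζ)).differentiableAt
    refine ⟨hU', hd, ?_⟩
    have hcomp : (f ∘ Φ.symm) =ᶠ[𝓝 ζ] id := by
      filter_upwards [Φ.open_target.mem_nhds (hball hζ)] with y hy
      have := Φ.right_inv hy
      rwa [hΦ] at this
    have h1 : deriv f (Φ.symm ζ) * deriv Φ.symm ζ = 1 := by
      rw [← deriv_comp ζ (hfa _ hU').differentiableAt hd, hcomp.deriv_eq, deriv_id]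
    have h2 : f (Φ.symm ζ) = ζ := hcomp.eq_of_nhds
    rw [← (hf _ hU').2.2, h2, mul_assoc, ← norm_mul, h1, norm_one, mul_one]
  set h := g ∘ Φ.symm with hh_def
  have hh : IsLocalIsometry (Metric.ball 0 δ) discDensity disc discDensity h := hg.comp hsymm
  have hh0 : h 0 = 0 := by simp [hh_def, hs0, hg0]
  have hd0 : ‖deriv h 0‖ = 1 := by
    have := (hh 0 (Metric.mem_ball_self hδ0)).2.2
    rw [hh0] at this
    simpa [discDensity] using this
  obtain ⟨c, hc, hcE⟩ := Complex.affine_of_mapsTo_ball_of_exists_norm_dslope_eq_div' (f := h)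
    (c := 0) (R₁ := δ) (R₂ := δ) hh.differentiableOn
    (by
      intro z hz
      rw [hh0, mem_closedBall_zero_iff]
      have := norm_le_norm_of_discIsometry (min_le_right _ _) hh hh0 hz
      have hz' : ‖z‖ < δ := by simpa using hz
      linarith)
    ⟨0, Metric.mem_ball_self hδ0, by rw [dslope_same, hd0, div_self hδ0.ne']⟩
  rw [div_self hδ0.ne'] at hc
  refine ⟨c, hc, ?_⟩
  have hev : g =ᶠ[𝓝 w₀] fun w => c * f w := by
    have hcont : ContinuousAt f w₀ := (hfa w₀ hw₀).continuousAt
    have : ∀ᶠ w in 𝓝 w₀, f w ∈ Metric.ball (0 : ℂ) δ := by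
      apply hcont.eventually_mem
      rw [hf0]
      exact Metric.ball_mem_nhds _ hδ0
    filter_upwards [this, Φ.open_source.mem_nhds hΦ0] with w hw hws
    have h1 := hcE hw
    have h2 := Φ.left_inv hws
    rw [hΦ] at h2
    simp only [hh_def, Function.comp_apply, h2, hs0, hg0, zero_add, sub_zero, smul_eq_mul] at h1
    rw [h1, mul_comm]
  exact hga.eqOn_of_preconnected_of_eventuallyEq (fun w hw => analyticAt_const.mul (hfa w hw)) hUc
    hw₀ hev

theorem isOpen_halfPlane : IsOpen halfPlane :=
  isOpen_lt continuous_const Complex.continuous_im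

theorem discDensity_eq {z : ℂ} : discDensity z = 2 / (1 - Complex.normSq z) := by
  rw [discDensity, Complex.sq_norm]

theorem mem_disc_iff_normSq {z : ℂ} : z ∈ disc ↔ Complex.normSq z < 1 := by
  rw [mem_disc, ← Complex.sq_norm, sq_lt_one_iff₀ (norm_nonneg z)]

/-! ### Isometries of the two models -/

section Disc

variable {a b z : ℂ}

theorem PSU11_normSq_sub (h : ‖a‖ ^ 2 - ‖b‖ ^ 2 = 1) (z : ℂ) :
    Complex.normSq (starRingEnd ℂ b * z + starRingEnd ℂ a) - Complex.normSq (a * z + b) =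
      1 - Complex.normSq z := by
  rw [Complex.sq_norm, Complex.sq_norm] at h
  simp only [Complex.normSq_apply, Complex.add_re, Complex.add_im, Complex.mul_re, Complex.mul_im,
    Complex.conj_re, Complex.conj_im] at h ⊢
  linear_combination (1 - z.re * z.re - z.im * z.im) * h

theorem PSU11_denom_ne_zero (h : ‖a‖ ^ 2 - ‖b‖ ^ 2 = 1) (hz : z ∈ disc) :
    starRingEnd ℂ b * z + starRingEnd ℂ a ≠ 0 := by
  intro h0
  have := PSU11_normSq_sub h z
  rw [h0, map_zero] at this
  rw [mem_disc_iff_normSq] at hz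
  linarith [Complex.normSq_nonneg (a * z + b)]

theorem PSU11_det (h : ‖a‖ ^ 2 - ‖b‖ ^ 2 = 1) :
    a * starRingEnd ℂ a - b * starRingEnd ℂ b = 1 := by
  rw [Complex.mul_conj', Complex.mul_conj']
  exact_mod_cast h

theorem isLocalIsometry_of_mem_PSU11 {L : ℂ → ℂ} (hL : L ∈ PSU11) :
    IsLocalIsometry disc discDensity disc discDensity L := by
  obtain ⟨a, b, h, rfl⟩ := hL
  intro z hz
  have hD := PSU11_denom_ne_zero h hz
  have hsub := PSU11_normSq_sub h z
  have hdet := PSU11_det h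
  have hDp : 0 < Complex.normSq (starRingEnd ℂ b * z + starRingEnd ℂ a) := Complex.normSq_pos.2 hD
  have hz' := mem_disc_iff_normSq.1 hz
  have hder : HasDerivAt (fun z : ℂ => (a * z + b) / (starRingEnd ℂ b * z + starRingEnd ℂ a))
      (1 / (starRingEnd ℂ b * z + starRingEnd ℂ a) ^ 2) z := by
    have h1 : HasDerivAt (fun z : ℂ => a * z + b) a z := by
      simpa using ((hasDerivAt_id z).const_mul a).add_const b
    have h2 : HasDerivAt (fun z : ℂ => starRingEnd ℂ b * z + starRingEnd ℂ a)
        (starRingEnd ℂ b) z := by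
      simpa using ((hasDerivAt_id z).const_mul (starRingEnd ℂ b)).add_const (starRingEnd ℂ a)
    refine (h1.div h2 hD).congr_deriv ?_
    congr 1
    linear_combination hdet
  have hq : Complex.normSq ((a * z + b) / (starRingEnd ℂ b * z + starRingEnd ℂ a)) =
      1 - (1 - Complex.normSq z) / Complex.normSq (starRingEnd ℂ b * z + starRingEnd ℂ a) := by
    rw [map_div₀, ← hsub, sub_div, div_self hDp.ne', sub_sub_cancel]
  have hpos : 0 < 1 - Complex.normSq z := by linarith
  refine ⟨?_, hder.differentiableAt, ?_⟩
  · rw [mem_disc_iff_normSq, hq]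
    have := div_pos hpos hDp
    linarith
  · rw [hder.deriv, discDensity_eq, discDensity_eq, hq, norm_div, norm_one, norm_pow,
      Complex.sq_norm, sub_sub_cancel]
    field_simp

theorem PSU11_comp {L M : ℂ → ℂ} (hL : L ∈ PSU11) (hM : M ∈ PSU11) :
    ∃ N ∈ PSU11, ∀ z ∈ disc, N z = M (L z) := by
  obtain ⟨a, b, h, rfl⟩ := hL
  obtain ⟨c, d, k, rfl⟩ := hM
  have hdet := PSU11_det h
  have kdet := PSU11_det k
  refine ⟨_, ⟨c * a + d * starRingEnd ℂ b, c * b + d * starRingEnd ℂ a, ?_, rfl⟩, ?_⟩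
  · have : (c * a + d * starRingEnd ℂ b) * starRingEnd ℂ (c * a + d * starRingEnd ℂ b) -
        (c * b + d * starRingEnd ℂ a) * starRingEnd ℂ (c * b + d * starRingEnd ℂ a) = 1 := by
      simp only [map_add, map_mul, Complex.conj_conj]
      linear_combination (c * starRingEnd ℂ c - d * starRingEnd ℂ d) * hdet + kdet
    rw [Complex.mul_conj', Complex.mul_conj'] at this
    exact_mod_cast this
  · intro z hz
    have hD := PSU11_denom_ne_zero h hz
    simp only [map_add, map_mul, Complex.conj_conj]
    field_simp
    ring_nf

theorem PSU11_inv {L : ℂ → ℂ} (hL : L ∈ PSU11) : ∃ M ∈ PSU11, ∀ z ∈ disc, M (L z) = z := by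
  obtain ⟨a, b, h, rfl⟩ := hL
  refine ⟨_, ⟨starRingEnd ℂ a, -b, by simpa using h, rfl⟩, ?_⟩
  intro z hz
  have hD := PSU11_denom_ne_zero h hz
  have hdet := PSU11_det h
  simp only [map_neg, Complex.conj_conj]
  have e1 : starRingEnd ℂ a * ((a * z + b) / (starRingEnd ℂ b * z + starRingEnd ℂ a)) + -b =
      z / (starRingEnd ℂ b * z + starRingEnd ℂ a) := by
    rw [eq_div_iff hD, add_mul, mul_assoc, div_mul_cancel₀ _ hD]
    linear_combination z * hdet
  have e2 : -starRingEnd ℂ b * ((a * z + b) / (starRingEnd ℂ b * z + starRingEnd ℂ a)) + a =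
      1 / (starRingEnd ℂ b * z + starRingEnd ℂ a) := by
    rw [eq_div_iff hD, add_mul, mul_assoc, div_mul_cancel₀ _ hD]
    linear_combination hdet
  rw [e1, e2, div_div_div_cancel_right₀ hD, div_one]

theorem exists_mem_PSU11_apply_eq_zero {α : ℂ} (hα : α ∈ disc) : ∃ L ∈ PSU11, L α = 0 := by
  have hα' := mem_disc_iff_normSq.1 hα
  have hpos : 0 < 1 - Complex.normSq α := by linarith
  set s : ℝ := (Real.sqrt (1 - Complex.normSq α))⁻¹
  have hs : s ^ 2 * (1 - Complex.normSq α) = 1 := by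
    rw [inv_pow, Real.sq_sqrt hpos.le, inv_mul_cancel₀ hpos.ne']
  refine ⟨_, ⟨s, -(s * α), ?_, rfl⟩, ?_⟩
  · rw [norm_neg, norm_mul, mul_pow, Complex.sq_norm α, Complex.norm_real, Real.norm_eq_abs,
      sq_abs]
    linear_combination hs
  · simp

theorem rotation_mem_PSU11 {c : ℂ} (hc : ‖c‖ = 1) : (fun z => c * z) ∈ PSU11 := by
  obtain ⟨u, hu⟩ := IsAlgClosed.exists_pow_nat_eq c two_pos
  have hu1 : ‖u‖ = 1 := by
    have : ‖u‖ ^ 2 = 1 := by rw [← norm_pow, hu, hc]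
    exact (pow_eq_one_iff_of_nonneg (norm_nonneg u) two_ne_zero).1 this
  refine ⟨u, 0, by simp [hu1], ?_⟩
  have hu' : u * starRingEnd ℂ u = 1 := by rw [Complex.mul_conj', hu1]; simp
  have h0 : starRingEnd ℂ u ≠ 0 := right_ne_zero_of_mul_eq_one hu'
  funext z
  simp only [map_zero, zero_mul, zero_add, add_zero]
  rw [eq_div_iff h0, ← hu]
  linear_combination u * z * hu'

/-- Local isometries into the unit disc with the same pulled back metric differ by an element of
`PSU(1,1)`. -/
theorem disc_rigidity {U : Set ℂ} {σ : ℂ → ℝ} {f g : ℂ → ℂ} (hU : IsOpen U)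
    (hUc : IsPreconnected U) (hUn : U.Nonempty) (hσ : ∀ w ∈ U, 0 < σ w)
    (hf : IsLocalIsometry U σ disc discDensity f) (hg : IsLocalIsometry U σ disc discDensity g) :
    ∃ L ∈ PSU11, ∀ w ∈ U, L (f w) = g w := by
  obtain ⟨w₀, hw₀⟩ := hUn
  obtain ⟨A, hA, hA0⟩ := exists_mem_PSU11_apply_eq_zero (hf w₀ hw₀).1
  obtain ⟨B, hB, hB0⟩ := exists_mem_PSU11_apply_eq_zero (hg w₀ hw₀).1
  obtain ⟨B', hB', hBB⟩ := PSU11_inv hB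
  have hAi := isLocalIsometry_of_mem_PSU11 hA
  obtain ⟨c, hc, hcE⟩ := eq_rotation_of_isLocalIsometry hU hUc hσ (hAi.comp hf)
    ((isLocalIsometry_of_mem_PSU11 hB).comp hg) hw₀ hA0 hB0
  obtain ⟨M, hM, hME⟩ := PSU11_comp hA (rotation_mem_PSU11 hc)
  obtain ⟨N, hN, hNE⟩ := PSU11_comp hM hB'
  refine ⟨N, hN, fun w hw => ?_⟩
  have h1 := (hf w hw).1
  rw [hNE _ h1, hME _ h1, ← hBB _ (hg w hw).1]
  exact congrArg B' (hcE w hw).symm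

end Disc

section HalfPlane

theorem PSL2R_denom_ne_zero {a b c d : ℝ} (h : a * d - b * c = 1) {z : ℂ} (hz : z ∈ halfPlane) :
    (c * z + d : ℂ) ≠ 0 := by
  intro h0
  have hz' : 0 < z.im := hz
  have h1 := congrArg Complex.im h0
  have h2 := congrArg Complex.re h0
  simp at h1 h2
  rcases h1 with h1 | h1
  · rw [h1] at h2 h
    simp at h2
    rw [h2] at h
    simp at h
  · exact hz'.ne' h1

theorem isLocalIsometry_of_mem_PSL2R {L : ℂ → ℂ} (hL : L ∈ PSL2R) :
    IsLocalIsometry halfPlane halfPlaneDensity halfPlane halfPlaneDensity L := by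
  obtain ⟨a, b, c, d, h, rfl⟩ := hL
  intro z hz
  have hD := PSL2R_denom_ne_zero h hz
  have hDp : 0 < Complex.normSq (c * z + d : ℂ) := Complex.normSq_pos.2 hD
  have hz' : 0 < z.im := hz
  have hdet : (a * d - b * c : ℂ) = 1 := by exact_mod_cast h
  have hder : HasDerivAt (fun z : ℂ => (a * z + b) / (c * z + d))
      (1 / (c * z + d : ℂ) ^ 2) z := by
    have h1 : HasDerivAt (fun z : ℂ => a * z + b) (a : ℂ) z := by
      simpa using ((hasDerivAt_id z).const_mul (a : ℂ)).add_const (b : ℂ)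
    have h2 : HasDerivAt (fun z : ℂ => c * z + d) (c : ℂ) z := by
      simpa using ((hasDerivAt_id z).const_mul (c : ℂ)).add_const (d : ℂ)
    refine (h1.div h2 hD).congr_deriv ?_
    congr 1
    linear_combination hdet
  have him : ((a * z + b) / (c * z + d) : ℂ).im = z.im / Complex.normSq (c * z + d : ℂ) := by
    rw [Complex.div_im]
    rw [div_sub_div_same]
    congr 1
    simp
    linear_combination z.im * h
  refine ⟨?_, hder.differentiableAt, ?_⟩
  · show 0 < Complex.im _
    rw [him]
    exact div_pos hz' hDp
  · rw [hder.deriv, halfPlaneDensity, him, halfPlaneDensity, norm_div, norm_one, norm_pow,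
      Complex.sq_norm]
    field_simp

theorem PSL2R_comp {L M : ℂ → ℂ} (hL : L ∈ PSL2R) (hM : M ∈ PSL2R) :
    ∃ N ∈ PSL2R, ∀ z ∈ halfPlane, N z = M (L z) := by
  obtain ⟨a, b, c, d, h, rfl⟩ := hL
  obtain ⟨a', b', c', d', k, rfl⟩ := hM
  refine ⟨_, ⟨a' * a + b' * c, a' * b + b' * d, c' * a + d' * c, c' * b + d' * d, ?_, rfl⟩, ?_⟩
  · linear_combination (a * d - b * c) * k + h
  · intro z hz
    have hD := PSL2R_denom_ne_zero h hz
    push_cast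
    field_simp
    ring_nf

theorem PSL2R_inv {L : ℂ → ℂ} (hL : L ∈ PSL2R) :
    ∃ M ∈ PSL2R, ∀ z ∈ halfPlane, M (L z) = z := by
  obtain ⟨a, b, c, d, h, rfl⟩ := hL
  refine ⟨_, ⟨d, -b, -c, a, by linear_combination h, rfl⟩, ?_⟩
  intro z hz
  have hD := PSL2R_denom_ne_zero h hz
  have hdet : (a * d - b * c : ℂ) = 1 := by exact_mod_cast h
  have e1 : (d : ℂ) * ((a * z + b) / (c * z + d)) + (-b : ℝ) = z / (c * z + d) := by
    rw [eq_div_iff hD, add_mul, mul_assoc, div_mul_cancel₀ _ hD]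
    push_cast
    linear_combination z * hdet
  have e2 : ((-c : ℝ) : ℂ) * ((a * z + b) / (c * z + d)) + a = 1 / (c * z + d) := by
    rw [eq_div_iff hD, add_mul, mul_assoc, div_mul_cancel₀ _ hD]
    push_cast
    linear_combination hdet
  simp only
  rw [e1, e2, div_div_div_cancel_right₀ hD, div_one]

theorem exists_mem_PSL2R_apply_eq_I {α : ℂ} (hα : α ∈ halfPlane) :
    ∃ L ∈ PSL2R, L α = Complex.I := by
  have hα' : 0 < α.im := hα
  set s : ℝ := Real.sqrt α.im with hs
  have hs0 : 0 < s := Real.sqrt_pos.2 hα'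
  have hs2 : s * s = α.im := Real.mul_self_sqrt hα'.le
  refine ⟨_, ⟨s⁻¹, -(α.re * s⁻¹), 0, s, by field_simp; simp, rfl⟩, ?_⟩
  have hsc : (s : ℂ) ≠ 0 := by exact_mod_cast hs0.ne'
  have hs2c : (s : ℂ) * s = α.im := by exact_mod_cast hs2
  have hα2 := Complex.re_add_im α
  push_cast
  rw [zero_mul, zero_add, div_eq_iff hsc]
  field_simp
  rw [pow_two, hs2c]
  linear_combination -hα2

/-- The isometry of the upper half-plane onto the unit disc that takes `z₀` to the centre. -/
noncomputable def cayley (z₀ z : ℂ) : ℂ := (z - z₀) / (z - starRingEnd ℂ z₀)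

theorem cayley_denom_ne_zero {z₀ z : ℂ} (h₀ : z₀ ∈ halfPlane) (hz : z ∈ halfPlane) :
    z - starRingEnd ℂ z₀ ≠ 0 := by
  intro h
  have h1 := congrArg Complex.im h
  have h2 : 0 < z₀.im := h₀
  have h3 : 0 < z.im := hz
  simp at h1
  linarith

theorem isLocalIsometry_cayley {z₀ : ℂ} (h₀ : z₀ ∈ halfPlane) :
    IsLocalIsometry halfPlane halfPlaneDensity disc discDensity (cayley z₀) := by
  intro z hz
  have hD := cayley_denom_ne_zero h₀ hz
  have hDp : 0 < Complex.normSq (z - starRingEnd ℂ z₀) := Complex.normSq_pos.2 hD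
  have h2 : 0 < z₀.im := h₀
  have h3 : 0 < z.im := hz
  have hder : HasDerivAt (cayley z₀)
      ((z₀ - starRingEnd ℂ z₀) / (z - starRingEnd ℂ z₀) ^ 2) z := by
    have h1 : HasDerivAt (fun z : ℂ => z - z₀) 1 z := (hasDerivAt_id z).sub_const z₀
    have h2 : HasDerivAt (fun z : ℂ => z - starRingEnd ℂ z₀) 1 z :=
      (hasDerivAt_id z).sub_const _
    refine (h1.div h2 hD).congr_deriv ?_
    congr 1
    ring
  have hq : Complex.normSq (cayley z₀ z) =
      1 - 4 * z.im * z₀.im / Complex.normSq (z - starRingEnd ℂ z₀) := by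
    rw [cayley, map_div₀]
    field_simp
    simp only [Complex.normSq_apply, Complex.sub_re, Complex.sub_im, Complex.conj_re,
      Complex.conj_im]
    ring
  have hn : ‖z₀ - starRingEnd ℂ z₀‖ = 2 * z₀.im := by
    rw [Complex.sub_conj]
    simp [abs_of_pos h2]
  refine ⟨?_, hder.differentiableAt, ?_⟩
  · rw [mem_disc_iff_normSq, hq]
    have : 0 < 4 * z.im * z₀.im / Complex.normSq (z - starRingEnd ℂ z₀) := by positivity
    linarith
  · rw [hder.deriv, discDensity_eq, hq, sub_sub_cancel, norm_div, norm_pow, Complex.sq_norm, hn,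
      halfPlaneDensity]
    field_simp
    norm_num

theorem cayley_self (z₀ : ℂ) : cayley z₀ z₀ = 0 := by simp [cayley]

theorem cayley_injOn {z₀ : ℂ} (h₀ : z₀ ∈ halfPlane) : InjOn (cayley z₀) halfPlane := by
  intro z hz w hw h
  have h1 := cayley_denom_ne_zero h₀ hz
  have h2 := cayley_denom_ne_zero h₀ hw
  rw [cayley, cayley, div_eq_div_iff h1 h2] at h
  have h3 : (z₀ - starRingEnd ℂ z₀) * (z - w) = 0 := by linear_combination h
  exact sub_eq_zero.1 ((mul_eq_zero.1 h3).resolve_left (cayley_denom_ne_zero h₀ h₀))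

/-- The isometry of the unit disc onto the upper half-plane inverse to `cayley I`. -/
noncomputable def inverseCayley (w : ℂ) : ℂ := Complex.I * (1 + w) / (1 - w)

theorem isLocalIsometry_inverseCayley :
    IsLocalIsometry disc discDensity halfPlane halfPlaneDensity inverseCayley := by
  intro w hw
  have hw' := mem_disc_iff_normSq.1 hw
  have hD : 1 - w ≠ 0 := by
    intro h
    rw [← sub_eq_zero.1 h] at hw'
    simp at hw'
  have hDp : 0 < Complex.normSq (1 - w) := Complex.normSq_pos.2 hD
  have hder : HasDerivAt inverseCayley (2 * Complex.I / (1 - w) ^ 2) w := by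
    have h1 : HasDerivAt (fun z : ℂ => Complex.I * (1 + z)) Complex.I w := by
      simpa using ((hasDerivAt_id w).const_add 1).const_mul Complex.I
    have h2 : HasDerivAt (fun z : ℂ => 1 - z) (-1) w := by
      simpa using (hasDerivAt_id w).const_sub 1
    refine (h1.div h2 hD).congr_deriv ?_
    congr 1
    ring
  have him : (inverseCayley w).im = (1 - Complex.normSq w) / Complex.normSq (1 - w) := by
    rw [inverseCayley, Complex.div_im]
    field_simp
    simp [Complex.normSq_apply]
    ring
  have hpos : 0 < 1 - Complex.normSq w := by linarith
  refine ⟨?_, hder.differentiableAt, ?_⟩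
  · show 0 < Complex.im _
    rw [him]
    exact div_pos hpos hDp
  · rw [hder.deriv, halfPlaneDensity, him, discDensity_eq, norm_div, norm_pow, Complex.sq_norm]
    simp
    field_simp

/-- Rotations of the disc are real transformations of the half-plane, with matrix
`(Re u, Im u; -Im u, Re u)` for a square root `u` of the rotation factor. -/
theorem exists_mem_PSL2R_cayley_rotation {c : ℂ} (hc : ‖c‖ = 1) :
    ∃ L ∈ PSL2R, ∀ z ∈ halfPlane, cayley Complex.I (L z) = c * cayley Complex.I z := by
  obtain ⟨u, hu⟩ := IsAlgClosed.exists_pow_nat_eq c two_pos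
  have hu1 : ‖u‖ = 1 := by
    have : ‖u‖ ^ 2 = 1 := by rw [← norm_pow, hu, hc]
    exact (pow_eq_one_iff_of_nonneg (norm_nonneg u) two_ne_zero).1 this
  have hdet : u.re * u.re - u.im * -u.im = 1 := by
    have : Complex.normSq u = 1 := by rw [← Complex.sq_norm, hu1, one_pow]
    rw [Complex.normSq_apply] at this
    linarith
  refine ⟨_, ⟨u.re, u.im, -u.im, u.re, hdet, rfl⟩, ?_⟩
  intro z hz
  have hD := PSL2R_denom_ne_zero hdet hz
  have hI : Complex.I ∈ halfPlane := by simp [halfPlane]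
  have hz2 := cayley_denom_ne_zero hI hz
  have hLz := cayley_denom_ne_zero hI
    (isLocalIsometry_of_mem_PSL2R ⟨u.re, u.im, -u.im, u.re, hdet, rfl⟩ z hz).1
  have hu' : u * starRingEnd ℂ u = 1 := by rw [Complex.mul_conj', hu1]; simp
  have hure : (u.re : ℂ) = u - u.im * Complex.I := by
    linear_combination (Complex.re_add_im u)
  have hcu : starRingEnd ℂ u = u - 2 * u.im * Complex.I := by
    apply Complex.ext <;> simp
    ring
  simp only [cayley, Complex.conj_I, sub_neg_eq_add] at hz2 hLz ⊢
  rw [← hu]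
  rw [← mul_div_assoc, div_eq_div_iff hLz hz2]
  rw [hcu] at hu'
  push_cast at hD hLz ⊢
  rw [hure] at hD ⊢
  have hII := Complex.I_mul_I
  set D := -(u.im : ℂ) * z + (u - u.im * Complex.I) with hDdef
  have e : ∀ y, ((u - u.im * Complex.I) * z + u.im) / D + y =
      ((u - u.im * Complex.I) * z + u.im + y * D) / D := by
    intro y; rw [div_add' _ _ _ hD]
  rw [sub_eq_add_neg, e, e, div_mul_eq_mul_div, mul_div_assoc', div_left_inj' hD]
  have n1 : (u - u.im * Complex.I) * z + u.im + -Complex.I * D = u * (z - Complex.I) := by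
    rw [hDdef]; linear_combination (u.im : ℂ) * hII
  have n2 : (u - u.im * Complex.I) * z + u.im + Complex.I * D =
      (u - 2 * u.im * Complex.I) * (z + Complex.I) := by
    rw [hDdef]; linear_combination (u.im : ℂ) * hII
  rw [n1, n2]
  linear_combination (-u * (z - Complex.I) * (z + Complex.I)) * hu'

/-- Local isometries into the upper half-plane with the same pulled back metric differ by an element
of `PSL(2,ℝ)`. -/
theorem halfPlane_rigidity {U : Set ℂ} {σ : ℂ → ℝ} {f g : ℂ → ℂ} (hU : IsOpen U)
    (hUc : IsPreconnected U) (hUn : U.Nonempty) (hσ : ∀ w ∈ U, 0 < σ w)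
    (hf : IsLocalIsometry U σ halfPlane halfPlaneDensity f)
    (hg : IsLocalIsometry U σ halfPlane halfPlaneDensity g) :
    ∃ L ∈ PSL2R, ∀ w ∈ U, L (f w) = g w := by
  obtain ⟨w₀, hw₀⟩ := hUn
  obtain ⟨A, hA, hA0⟩ := exists_mem_PSL2R_apply_eq_I (hf w₀ hw₀).1
  obtain ⟨B, hB, hB0⟩ := exists_mem_PSL2R_apply_eq_I (hg w₀ hw₀).1
  obtain ⟨B', hB', hBB⟩ := PSL2R_inv hB
  have hAi := isLocalIsometry_of_mem_PSL2R hA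
  have hBi := isLocalIsometry_of_mem_PSL2R hB
  have hI : Complex.I ∈ halfPlane := by simp [halfPlane]
  have hC := isLocalIsometry_cayley hI
  obtain ⟨c, hc, hcE⟩ := eq_rotation_of_isLocalIsometry hU hUc hσ (hC.comp (hAi.comp hf))
    (hC.comp (hBi.comp hg)) hw₀ (by simp [hA0, cayley_self]) (by simp [hB0, cayley_self])
  obtain ⟨R, hR, hRE⟩ := exists_mem_PSL2R_cayley_rotation hc
  obtain ⟨M, hM, hME⟩ := PSL2R_comp hA hR
  obtain ⟨N, hN, hNE⟩ := PSL2R_comp hM hB'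
  refine ⟨N, hN, fun w hw => ?_⟩
  have h1 := (hf w hw).1
  have h2 := (hg w hw).1
  rw [hNE _ h1, hME _ h1, ← hBB _ h2]
  have h3 := (hAi _ h1).1
  congr 1
  refine cayley_injOn hI ((isLocalIsometry_of_mem_PSL2R hR) _ h3).1 (hBi _ h2).1 ?_
  rw [hRE _ h3]
  exact (hcE w hw).symm

end HalfPlane

/-! ### Functions on a punctured disc and the logarithmic coordinate -/

theorem isOpen_re_lt (a : ℝ) : IsOpen {w : ℂ | w.re < a} :=
  isOpen_lt Complex.continuous_re continuous_const

theorem convex_re_lt (a : ℝ) : Convex ℝ {w : ℂ | w.re < a} := by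
  intro x hx y hy s t hs ht hst
  simp only [mem_ofPred_eq, Complex.add_re, Complex.real_smul, Complex.re_ofReal_mul] at hx hy ⊢
  rcases hs.eq_or_lt with rfl | hs
  · have : t = 1 := by linarith
    subst this; simpa using hy
  · have h1 := mul_lt_mul_of_pos_left hx hs
    have h2 := mul_le_mul_of_nonneg_left hy.le ht
    have : s * a + t * a = a := by rw [← add_mul, hst, one_mul]
    linarith

theorem nonempty_re_lt (a : ℝ) : {w : ℂ | w.re < a}.Nonempty := ⟨((a - 1 : ℝ) : ℂ), by simp⟩

theorem exp_mem_ball {a : ℝ} {w : ℂ} (hw : w.re < a) :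
    Complex.exp w ∈ Metric.ball (0 : ℂ) (Real.exp a) \ {0} := by
  simp [Complex.norm_exp, hw]

theorem log_re_lt {a : ℝ} {z : ℂ} (hz : z ∈ Metric.ball (0 : ℂ) (Real.exp a)) (h0 : z ≠ 0) :
    (Complex.log z).re < a := by
  rw [Complex.log_re, Real.log_lt_iff_lt_exp (norm_pos_iff.2 h0)]
  simpa using hz

/-- A property that holds near `0` off `0` holds at `exp w` once `Re w` is very negative. -/
theorem exists_forall_exp {p : ℂ → Prop} (h : ∀ᶠ z in 𝓝[≠] (0 : ℂ), p z) (a : ℝ) :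
    ∃ b ≤ a, ∀ w : ℂ, w.re < b → p (Complex.exp w) := by
  rw [eventually_nhdsWithin_iff, Metric.eventually_nhds_iff] at h
  obtain ⟨ε, hε, h⟩ := h
  refine ⟨min a (Real.log ε), min_le_left _ _, fun w hw => h ?_ (Complex.exp_ne_zero w)⟩
  rw [dist_zero_right, Complex.norm_exp, ← Real.lt_log_iff_exp_lt hε]
  exact hw.trans_le (min_le_right _ _)

theorem eq_of_exp_eq_of_periodic {a : ℝ} {h : ℂ → ℂ}
    (hp : ∀ w : ℂ, w.re < a → h (w + 2 * Real.pi * Complex.I) = h w) {v w : ℂ} (hw : w.re < a)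
    (hvw : Complex.exp v = Complex.exp w) : h v = h w := by
  have hnat : ∀ (n : ℕ) (w : ℂ), w.re < a → h (w + n * (2 * Real.pi * Complex.I)) = h w := by
    intro n
    induction n with
    | zero => simp
    | succ n ih =>
      intro w hw
      rw [← ih w hw, ← hp (w + n * (2 * Real.pi * Complex.I)) (by simpa using hw)]
      congr 1
      push_cast
      ring
  obtain ⟨n, hn⟩ := Complex.exp_eq_exp_iff_exists_int.1 hvw
  obtain ⟨m, rfl | rfl⟩ := n.eq_nat_or_neg
  · rw [hn]
    exact_mod_cast hnat m w hw
  · rw [← hnat m v (by rw [hn]; simpa using hw), hn]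
    congr 1
    push_cast
    ring

/-- A holomorphic function of `w = log z` with period `2πi` is a holomorphic function of `z`. -/
theorem exists_differentiableOn_comp_exp {a : ℝ} {h : ℂ → ℂ}
    (hd : DifferentiableOn ℂ h {w | w.re < a})
    (hp : ∀ w : ℂ, w.re < a → h (w + 2 * Real.pi * Complex.I) = h w) :
    ∃ H : ℂ → ℂ, DifferentiableOn ℂ H (Metric.ball 0 (Real.exp a) \ {0}) ∧
      ∀ w : ℂ, w.re < a → H (Complex.exp w) = h w := by
  refine ⟨fun z => h (Complex.log z), ?_, ?_⟩
  · intro z₀ hz₀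
    have h0 : z₀ ≠ 0 := hz₀.2
    have hre := log_re_lt hz₀.1 h0
    have hev : ∀ᶠ z in 𝓝 z₀, z ∈ Metric.ball (0 : ℂ) (Real.exp a) \ {0} :=
      (Metric.isOpen_ball.sdiff isClosed_singleton).mem_nhds hz₀
    have heq : (fun z => h (Complex.log z)) =ᶠ[𝓝 z₀]
        fun z => h (Complex.log z₀ + Complex.log (z / z₀)) := by
      filter_upwards [hev] with z hz
      refine (eq_of_exp_eq_of_periodic hp (log_re_lt hz.1 hz.2) ?_).symm
      rw [Complex.exp_add, Complex.exp_log h0, Complex.exp_log (div_ne_zero hz.2 h0),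
        Complex.exp_log hz.2, mul_div_cancel₀ _ h0]
    refine (DifferentiableAt.congr_of_eventuallyEq ?_ heq).differentiableWithinAt
    have h1 : DifferentiableAt ℂ (fun z => Complex.log z₀ + Complex.log (z / z₀)) z₀ := by
      refine (DifferentiableAt.clog (by fun_prop) ?_).const_add _
      rw [div_self h0]; simp
    refine DifferentiableAt.comp z₀ (g := h) ?_ h1
    rw [div_self h0, Complex.log_one, add_zero]
    exact (hd _ hre).differentiableAt ((isOpen_re_lt a).mem_nhds hre)
  · intro w hw
    exact eq_of_exp_eq_of_periodic hp hw (Complex.exp_log (Complex.exp_ne_zero w))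

/-- A bounded holomorphic function of `w = log z` whose monodromy is multiplication by
`exp (2πiγ)`, with `γ < 1`, is `z ^ γ` times a function holomorphic also at `z = 0`. -/
theorem exists_eq_exp_mul_of_quasiperiodic {a γ C : ℝ} (hγ1 : γ < 1) {g : ℂ → ℂ}
    (hd : DifferentiableOn ℂ g {w | w.re < a}) (hb : ∀ w : ℂ, w.re < a → ‖g w‖ ≤ C)
    (hp : ∀ w : ℂ, w.re < a →
      g (w + 2 * Real.pi * Complex.I) = Complex.exp (2 * Real.pi * Complex.I * γ) * g w) :
    ∃ G : ℂ → ℂ, DifferentiableOn ℂ G (Metric.ball 0 (Real.exp a)) ∧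
      ∀ w : ℂ, w.re < a → g w = Complex.exp (γ * w) * G (Complex.exp w) := by
  obtain ⟨H, hH, hHe⟩ := exists_differentiableOn_comp_exp (a := a)
    (h := fun w => Complex.exp (-(γ * w)) * g w)
    (DifferentiableOn.mul (by fun_prop) hd) (by
      intro w hw
      rw [hp w hw, ← mul_assoc, ← Complex.exp_add]
      congr 2
      ring)
  have hball : Metric.ball (0 : ℂ) (Real.exp a) ∈ 𝓝 (0 : ℂ) :=
    Metric.ball_mem_nhds _ (Real.exp_pos a)
  have hbound : ∀ z ∈ Metric.ball (0 : ℂ) (Real.exp a), z ≠ 0 → ‖H z * z‖ ≤ C * ‖z‖ ^ (1 - γ) := by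
    intro z hz h0
    have hre := log_re_lt hz h0
    have h1 := hHe _ hre
    rw [Complex.exp_log h0] at h1
    have hz0 : 0 < ‖z‖ := norm_pos_iff.2 h0
    have h2 : ‖Complex.exp (-(γ * Complex.log z))‖ = ‖z‖ ^ (-γ) := by
      rw [Complex.norm_exp, Real.rpow_def_of_pos hz0]
      congr 1
      simp [Complex.log_re, mul_comm]
    rw [norm_mul, h1, norm_mul, h2, sub_eq_neg_add, Real.rpow_add hz0, Real.rpow_one,
      ← mul_assoc, mul_comm C]
    have := hb _ hre
    gcongr
  have ho : (fun z => H z - H 0) =o[𝓝[≠] 0] fun z : ℂ => (z - 0)⁻¹ := by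
    rw [Asymptotics.isLittleO_iff_tendsto']
    · have ht : Tendsto (fun z : ℂ => C * ‖z‖ ^ (1 - γ) + ‖H 0‖ * ‖z‖) (𝓝[≠] 0) (𝓝 0) := by
        have hn : Tendsto (fun z : ℂ => ‖z‖) (𝓝[≠] 0) (𝓝 0) :=
          (continuous_norm.tendsto' 0 0 norm_zero).mono_left nhdsWithin_le_nhds
        have h1 : Tendsto (fun z : ℂ => ‖z‖ ^ (1 - γ)) (𝓝[≠] 0) (𝓝 0) := by
          have := hn.rpow_const (p := 1 - γ) (Or.inr (by linarith))
          rwa [Real.zero_rpow (by linarith)] at this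
        simpa using (h1.const_mul C).add (hn.const_mul ‖H 0‖)
      refine squeeze_zero_norm' ?_ ht
      filter_upwards [self_mem_nhdsWithin, mem_nhdsWithin_of_mem_nhds hball] with z h0 hz
      rw [sub_zero, div_inv_eq_mul, sub_mul]
      refine (norm_sub_le _ _).trans (add_le_add (hbound z hz h0) (norm_mul_le _ _))
    · filter_upwards [self_mem_nhdsWithin] with z h0 h
      simp at h
      exact absurd h h0
  refine ⟨_, Complex.differentiableOn_update_limUnder_of_isLittleO hball hH ho, ?_⟩
  intro w hw
  rw [Function.update_of_ne (Complex.exp_ne_zero w), hHe w hw, ← mul_assoc, ← Complex.exp_add]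
  simp

/-- A local holomorphic logarithm of a nonvanishing function. -/
theorem exists_analyticAt_log {G : ℂ → ℂ} (hG : AnalyticAt ℂ G 0) (h0 : G 0 ≠ 0) :
    ∃ k : ℂ → ℂ, AnalyticAt ℂ k 0 ∧ ∀ᶠ z in 𝓝 0, G z = Complex.exp (k z) := by
  refine ⟨fun z => Complex.log (G z / G 0) + Complex.log (G 0), ?_, ?_⟩
  · refine AnalyticAt.add (AnalyticAt.clog (hG.div analyticAt_const h0) ?_) analyticAt_const
    rw [div_self h0]; simp
  · filter_upwards [hG.continuousAt.eventually_ne h0] with z hz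
    rw [Complex.exp_add, Complex.exp_log (div_ne_zero hz h0), Complex.exp_log h0,
      div_mul_cancel₀ _ h0]

/-! ### The model singularities -/

/-- The density of the metric of the unit disc pulled back by `z ↦ z ^ γ`. -/
noncomputable def coneDensity (γ : ℝ) (z : ℂ) : ℝ :=
  2 / (1 - (‖z‖ ^ γ) ^ 2) * (γ * ‖z‖ ^ γ) / ‖z‖

/-- The density of the metric of the upper half-plane pulled back by `z ↦ -i log z`. -/
noncomputable def cuspDensity (z : ℂ) : ℝ := 1 / (-Real.log ‖z‖ * ‖z‖)

/-- The density of the metric `ρ² |dz|²` in the logarithmic coordinate `w = log z`. -/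
noncomputable def logDensity (ρ : ℂ → ℝ) (w : ℂ) : ℝ := ρ (Complex.exp w) * ‖Complex.exp w‖

/-- In some holomorphic coordinate `ψ` centred at `0`, the metric `ρ² |dz|²` of a punctured
neighbourhood of `0` becomes `μ² |dζ|²`. -/
def IsLocallyModelledOn (ρ μ : ℂ → ℝ) : Prop :=
  ∃ ψ : ℂ → ℂ, AnalyticAt ℂ ψ 0 ∧ ψ 0 = 0 ∧ deriv ψ 0 ≠ 0 ∧
    ∀ᶠ z in 𝓝[≠] (0 : ℂ), ρ z = μ (ψ z) * ‖deriv ψ z‖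

theorem isLocalIsometry_exp_mul {γ : ℝ} (hγ : 0 < γ) :
    IsLocalIsometry {w | w.re < 0} (logDensity (coneDensity γ)) disc discDensity
      (fun w => Complex.exp (γ * w)) := by
  intro w hw
  have hder : HasDerivAt (fun w : ℂ => Complex.exp (γ * w)) (Complex.exp (γ * w) * γ) w := by
    have : HasDerivAt (fun w : ℂ => (γ : ℂ) * w) γ w := by
      simpa using (hasDerivAt_id w).const_mul (γ : ℂ)
    exact this.cexp
  have hn : ‖Complex.exp (γ * w)‖ = ‖Complex.exp w‖ ^ γ := by
    rw [Complex.norm_exp, Complex.norm_exp, ← Real.exp_mul]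
    simp [mul_comm]
  refine ⟨?_, hder.differentiableAt, ?_⟩
  · rw [mem_disc, Complex.norm_exp]
    simpa using mul_neg_of_pos_of_neg hγ hw
  · have h0 : ‖Complex.exp w‖ ≠ 0 := by simp
    rw [hder.deriv, norm_mul, discDensity, hn, logDensity, coneDensity, div_mul_cancel₀ _ h0,
      Complex.norm_real, Real.norm_of_nonneg hγ.le, mul_comm γ]

theorem isLocalIsometry_neg_I_mul :
    IsLocalIsometry {w | w.re < 0} (logDensity cuspDensity) halfPlane halfPlaneDensity
      (fun w => -Complex.I * w) := by
  intro w hw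
  have hder : HasDerivAt (fun w : ℂ => -Complex.I * w) (-Complex.I) w := by
    simpa using (hasDerivAt_id w).const_mul (-Complex.I)
  have hw' : w.re < 0 := hw
  refine ⟨by simpa [halfPlane] using hw', hder.differentiableAt, ?_⟩
  have h0 : ‖Complex.exp w‖ ≠ 0 := by simp
  have h1 : Real.log ‖Complex.exp w‖ = w.re := by rw [Complex.norm_exp, Real.log_exp]
  rw [hder.deriv, logDensity, cuspDensity, h1, halfPlaneDensity]
  field_simp
  simp

/-- If a branch of the developing map has the form `z ^ γ G(z)` with `G(0) ≠ 0`, then it is the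
`γ`-th power of the coordinate `z G(z) ^ (1 / γ)`. -/
theorem isLocallyModelledOn_cone {ρ : ℂ → ℝ} {f G : ℂ → ℂ} {a γ : ℝ} (hγ : 0 < γ)
    (hf : IsLocalIsometry {w | w.re < a} (logDensity ρ) disc discDensity f)
    (hG : AnalyticAt ℂ G 0) (hG0 : G 0 ≠ 0)
    (hfG : ∀ w : ℂ, w.re < a → f w = Complex.exp (γ * w) * G (Complex.exp w)) :
    IsLocallyModelledOn ρ (coneDensity γ) := by
  obtain ⟨k', hk', hkG⟩ := exists_analyticAt_log hG hG0
  have hγc : (γ : ℂ) ≠ 0 := by exact_mod_cast hγ.ne'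
  set k : ℂ → ℂ := fun z => k' z / γ with hk_def
  have hk : AnalyticAt ℂ k 0 := hk'.div analyticAt_const hγc
  have hpsi : ∀ z, AnalyticAt ℂ k z →
      HasDerivAt (fun z => z * Complex.exp (k z)) (Complex.exp (k z) * (1 + z * deriv k z)) z := by
    intro z hz
    refine ((hasDerivAt_id z).mul hz.differentiableAt.hasDerivAt.cexp).congr_deriv ?_
    simp only [id]
    ring
  refine ⟨fun z => z * Complex.exp (k z), analyticAt_id.mul hk.cexp, by simp, ?_, ?_⟩
  · rw [(hpsi 0 hk).deriv]
    simp
  · have hball : Metric.ball (0 : ℂ) (Real.exp a) ∈ 𝓝 (0 : ℂ) :=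
      Metric.ball_mem_nhds _ (Real.exp_pos a)
    filter_upwards [self_mem_nhdsWithin, mem_nhdsWithin_of_mem_nhds hball,
      mem_nhdsWithin_of_mem_nhds hk.eventually_analyticAt,
      mem_nhdsWithin_of_mem_nhds (eventually_eventually_nhds.2 hkG)] with z h0 hz hkz hGz
    have h0 : z ≠ 0 := h0
    set w := Complex.log z with hw_def
    have hw : w.re < a := log_re_lt hz h0
    have hez : Complex.exp w = z := Complex.exp_log h0
    have hfk : f =ᶠ[𝓝 w] fun w => Complex.exp (γ * (w + k (Complex.exp w))) := by
      have hc : Tendsto Complex.exp (𝓝 w) (𝓝 z) := by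
        rw [← hez]; exact Complex.continuous_exp.continuousAt
      filter_upwards [(isOpen_re_lt a).mem_nhds hw, hc.eventually hGz] with v hv hGv
      rw [hfG v hv, hGv, ← Complex.exp_add]
      congr 1
      simp only [hk_def]
      field_simp
    have hder : HasDerivAt (fun w => Complex.exp (γ * (w + k (Complex.exp w))))
        (Complex.exp (γ * (w + k z)) * (γ * (1 + deriv k z * z))) w := by
      have h1 : HasDerivAt (fun w => k (Complex.exp w)) (deriv k z * z) w := by
        have h2 := (Complex.hasDerivAt_exp w)
        rw [hez] at h2
        have h3 : HasDerivAt k (deriv k z) (Complex.exp w) := by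
          rw [hez]; exact hkz.differentiableAt.hasDerivAt
        exact h3.comp w h2
      have h4 := (((hasDerivAt_id w).add h1).const_mul (γ : ℂ)).cexp
      simpa only [id, Pi.add_apply, hez] using h4
    obtain ⟨-, -, h3⟩ := hf w hw
    rw [hfk.eq_of_nhds, hfk.deriv_eq, hder.deriv, hez, logDensity, hez] at h3
    have hpn : ‖z * Complex.exp (k z)‖ = Real.exp (w + k z).re := by
      rw [← hez, ← Complex.exp_add, Complex.norm_exp, hez]
    have hpg : ‖Complex.exp (γ * (w + k z))‖ = ‖z * Complex.exp (k z)‖ ^ γ := by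
      rw [hpn, ← Real.exp_mul, Complex.norm_exp, Complex.re_ofReal_mul, mul_comm]
    rw [(hpsi z hkz).deriv, coneDensity]
    rw [discDensity, norm_mul, hpg, norm_mul (γ : ℂ), Complex.norm_real,
      Real.norm_of_nonneg hγ.le] at h3
    have hz0 : ‖z‖ ≠ 0 := norm_ne_zero_iff.2 h0
    have hek : ‖Complex.exp (k z)‖ ≠ 0 := by simp
    apply mul_right_cancel₀ hz0
    rw [← h3, norm_mul z, norm_mul (Complex.exp (k z)), mul_comm (deriv k z)]
    generalize (2 / (1 - ((‖z‖ * ‖Complex.exp (k z)‖) ^ γ) ^ 2)) = X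
    field_simp

/-- If `exp (i f)` is a coordinate `ψ`, where `f` is a branch of the developing map, then `f` is
`-i log ψ`. -/
theorem isLocallyModelledOn_cusp {ρ : ℂ → ℝ} {f ψ : ℂ → ℂ} {a : ℝ}
    (hf : IsLocalIsometry {w | w.re < a} (logDensity ρ) halfPlane halfPlaneDensity f)
    (hψ : AnalyticAt ℂ ψ 0) (hψ0 : ψ 0 = 0) (hψ' : deriv ψ 0 ≠ 0)
    (hfψ : ∀ w : ℂ, w.re < a → Complex.exp (Complex.I * f w) = ψ (Complex.exp w)) :
    IsLocallyModelledOn ρ cuspDensity := by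
  refine ⟨ψ, hψ, hψ0, hψ', ?_⟩
  have hball : Metric.ball (0 : ℂ) (Real.exp a) ∈ 𝓝 (0 : ℂ) :=
    Metric.ball_mem_nhds _ (Real.exp_pos a)
  filter_upwards [self_mem_nhdsWithin, mem_nhdsWithin_of_mem_nhds hball,
    mem_nhdsWithin_of_mem_nhds hψ.eventually_analyticAt] with z h0 hz hψz
  have h0 : z ≠ 0 := h0
  set w := Complex.log z with hw_def
  have hw : w.re < a := log_re_lt hz h0
  have hez : Complex.exp w = z := Complex.exp_log h0
  obtain ⟨h1, h2, h3⟩ := hf w hw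
  have him : 0 < (f w).im := h1
  have hev : (fun w => Complex.exp (Complex.I * f w)) =ᶠ[𝓝 w] fun w => ψ (Complex.exp w) := by
    filter_upwards [(isOpen_re_lt a).mem_nhds hw] with v hv using hfψ v hv
  have hd1 : HasDerivAt (fun w => Complex.exp (Complex.I * f w))
      (Complex.exp (Complex.I * f w) * (Complex.I * deriv f w)) w :=
    (h2.hasDerivAt.const_mul Complex.I).cexp
  have hd2 : HasDerivAt (fun w => ψ (Complex.exp w)) (deriv ψ z * z) w := by
    have h2 := (Complex.hasDerivAt_exp w)
    rw [hez] at h2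
    have h3 : HasDerivAt ψ (deriv ψ z) (Complex.exp w) := by
      rw [hez]; exact hψz.differentiableAt.hasDerivAt
    exact h3.comp w h2
  have hde := hev.deriv_eq
  rw [hd1.deriv, hd2.deriv, hfψ w hw, hez] at hde
  have hψn : ‖ψ z‖ = Real.exp (-(f w).im) := by
    rw [← hez, ← hfψ w hw, Complex.norm_exp]
    simp
  have hn := congrArg norm hde
  rw [norm_mul, norm_mul, norm_mul, Complex.norm_I, one_mul] at hn
  rw [logDensity, hez, halfPlaneDensity] at h3
  have hz0 : ‖z‖ ≠ 0 := norm_ne_zero_iff.2 h0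
  have hψz0 : ‖ψ z‖ ≠ 0 := by rw [hψn]; exact (Real.exp_pos _).ne'
  apply mul_right_cancel₀ hz0
  rw [← h3, cuspDensity]
  have : -Real.log ‖ψ z‖ = (f w).im := by rw [hψn, Real.log_exp, neg_neg]
  rw [this, mul_assoc, ← hn]
  field_simp

/-! ### Classification of the monodromy at a puncture -/

section Monodromy

variable {ρ : ℂ → ℝ} {f : ℂ → ℂ} {a : ℝ}

theorem logDensity_add_two_pi (ρ : ℂ → ℝ) (w : ℂ) :
    logDensity ρ (w + 2 * Real.pi * Complex.I) = logDensity ρ w := by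
  rw [logDensity, Complex.exp_add, Complex.exp_two_pi_mul_I, mul_one, logDensity]

theorem deriv_eq_zero_of_forall_re_lt_eq {b : ℝ} {c : ℂ} (h : ∀ w : ℂ, w.re < b → f w = c) {w : ℂ}
    (hw : w.re < b) : deriv f w = 0 := by
  have : f =ᶠ[𝓝 w] fun _ => c := by
    filter_upwards [(isOpen_re_lt b).mem_nhds hw] with v hv using h v hv
  rw [this.deriv_eq, deriv_const]

/-- Factoring out the zero at the puncture: a developing map `z ^ γ G(z)`, where `G` is holomorphic
at `0`, is modelled on a cone. -/
theorem exists_isLocallyModelledOn_cone_of_eq_exp_mul {γ : ℝ} (hγ : 0 ≤ γ)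
    (hσ : ∀ w : ℂ, w.re < a → 0 < logDensity ρ w)
    (hf : IsLocalIsometry {w | w.re < a} (logDensity ρ) disc discDensity f) {G : ℂ → ℂ}
    (hG : AnalyticAt ℂ G 0)
    (hfG : ∀ w : ℂ, w.re < a → f w = Complex.exp (γ * w) * G (Complex.exp w))
    (h0 : 0 < γ ∨ G 0 = 0) : ∃ γ' > 0, IsLocallyModelledOn ρ (coneDensity γ') := by
  have hne : ¬ ∀ᶠ z in 𝓝 0, G z = 0 := by
    intro h
    obtain ⟨b, hba, hb⟩ := exists_forall_exp (h.filter_mono nhdsWithin_le_nhds) a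
    obtain ⟨w, hw⟩ := nonempty_re_lt b
    have hw : w.re < b := hw
    refine hf.deriv_ne_zero (hw.trans_le hba) (hσ w (hw.trans_le hba)) ?_
    refine deriv_eq_zero_of_forall_re_lt_eq (b := b) (c := 0) (fun v hv => ?_) hw
    rw [hfG v (hv.trans_le hba), hb v hv, mul_zero]
  obtain ⟨n, G₁, hG₁, hG₁0, hGn⟩ := hG.exists_eventuallyEq_pow_smul_nonzero_iff.2 hne
  obtain ⟨b, hba, hb⟩ := exists_forall_exp (hGn.filter_mono nhdsWithin_le_nhds) a
  have hpos : 0 < γ + n := by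
    rcases h0 with h0 | h0
    · positivity
    · have hn : n ≠ 0 := by
        rintro rfl
        have := hGn.self_of_nhds
        simp [h0] at this
        exact hG₁0 this.symm
      have : 0 < (n : ℝ) := by exact_mod_cast Nat.pos_of_ne_zero hn
      linarith
  refine ⟨γ + n, hpos, isLocallyModelledOn_cone (a := b) hpos
    (hf.mono fun w hw => lt_of_lt_of_le hw hba) hG₁ hG₁0 ?_⟩
  intro w hw
  rw [hfG w (hw.trans_le hba), hb w hw, sub_zero, smul_eq_mul, ← Complex.exp_nat_mul, ← mul_assoc,
    ← Complex.exp_add]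
  push_cast
  ring_nf

/-- Elliptic or trivial monodromy: the metric is modelled on a cone. -/
theorem exists_isLocallyModelledOn_cone_of_rotation
    (hσ : ∀ w : ℂ, w.re < a → 0 < logDensity ρ w)
    (hf : IsLocalIsometry {w | w.re < a} (logDensity ρ) disc discDensity f) {c : ℂ} (hc : ‖c‖ = 1)
    (hp : ∀ w : ℂ, w.re < a → f (w + 2 * Real.pi * Complex.I) = c * f w) :
    ∃ γ > 0, IsLocallyModelledOn ρ (coneDensity γ) := by
  obtain ⟨γ, hγ0, hγ1, hcγ⟩ : ∃ γ : ℝ, 0 ≤ γ ∧ γ < 1 ∧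
      c = Complex.exp (2 * Real.pi * Complex.I * γ) := by
    refine ⟨Int.fract (c.arg / (2 * Real.pi)), Int.fract_nonneg _, Int.fract_lt_one _, ?_⟩
    have h1 : c = Complex.exp (c.arg * Complex.I) := by
      conv_lhs => rw [← Complex.norm_mul_exp_arg_mul_I c, hc]
      simp
    have hpi : (Real.pi : ℂ) ≠ 0 := by exact_mod_cast Real.pi_ne_zero
    conv_lhs => rw [h1]
    rw [Complex.exp_eq_exp_iff_exists_int]
    refine ⟨⌊c.arg / (2 * Real.pi)⌋, ?_⟩
    have h2 := Int.floor_add_fract (c.arg / (2 * Real.pi))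
    have h3 : (c.arg : ℂ) = 2 * Real.pi *
        ((⌊c.arg / (2 * Real.pi)⌋ : ℂ) + (Int.fract (c.arg / (2 * Real.pi)) : ℝ)) := by
      have : c.arg = 2 * Real.pi * ((⌊c.arg / (2 * Real.pi)⌋ : ℝ) +
          Int.fract (c.arg / (2 * Real.pi))) := by
        rw [h2]; field_simp
      exact_mod_cast this
    conv_lhs => rw [h3]
    ring
  have hb : ∀ w : ℂ, w.re < a → ‖f w‖ < 1 := fun w hw => mem_disc.1 (hf w hw).1
  obtain ⟨G, hG, hfG⟩ := exists_eq_exp_mul_of_quasiperiodic hγ1 hf.differentiableOn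
    (fun w hw => (hb w hw).le) (by rw [← hcγ]; exact hp)
  have h0mem : (0 : ℂ) ∈ Metric.ball (0 : ℂ) (Real.exp a) := Metric.mem_ball_self (Real.exp_pos a)
  have hGa : AnalyticAt ℂ G 0 := hG.analyticAt (Metric.isOpen_ball.mem_nhds h0mem)
  rcases hγ0.lt_or_eq with hγ | rfl
  · exact exists_isLocallyModelledOn_cone_of_eq_exp_mul hγ0 hσ hf hGa hfG (Or.inl hγ)
  -- Trivial monodromy: `G` is a map into the disc, and `G 0` can be moved to the centre.
  have hfG' : ∀ w : ℂ, w.re < a → f w = G (Complex.exp w) := by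
    intro w hw; simpa using hfG w hw
  have hGlt : ∀ z ∈ Metric.ball (0 : ℂ) (Real.exp a), z ≠ 0 → ‖G z‖ < 1 := by
    intro z hz h0
    have h1 := hfG' _ (log_re_lt hz h0)
    rw [Complex.exp_log h0] at h1
    rw [← h1]
    exact hb _ (log_re_lt hz h0)
  have hG0le : ‖G 0‖ ≤ 1 := by
    have ht : Tendsto (fun z => ‖G z‖) (𝓝[≠] 0) (𝓝 ‖G 0‖) :=
      hGa.continuousAt.norm.tendsto.mono_left nhdsWithin_le_nhds
    refine le_of_tendsto ht ?_
    filter_upwards [self_mem_nhdsWithin,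
      mem_nhdsWithin_of_mem_nhds (Metric.isOpen_ball.mem_nhds h0mem)] with z h0 hz
    exact (hGlt z hz h0).le
  have hG0 : G 0 ∈ disc := by
    rw [mem_disc]
    refine hG0le.lt_of_ne fun h1 => ?_
    have hmax : IsMaxOn (norm ∘ G) (Metric.ball (0 : ℂ) (Real.exp a)) 0 := by
      intro z hz
      rcases eq_or_ne z 0 with rfl | h0
      · show ‖G 0‖ ≤ ‖G 0‖
        exact le_rfl
      · show ‖G z‖ ≤ ‖G 0‖
        rw [h1]; exact (hGlt z hz h0).le
    have hconst := Complex.eqOn_of_isPreconnected_of_isMaxOn_norm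
      (convex_ball (0 : ℂ) (Real.exp a)).isPreconnected Metric.isOpen_ball hG h0mem hmax
    obtain ⟨w, hw⟩ := nonempty_re_lt a
    refine hf.deriv_ne_zero hw (hσ w hw) ?_
    refine deriv_eq_zero_of_forall_re_lt_eq (b := a) (c := G 0) (fun v hv => ?_) hw
    rw [hfG' v hv]
    exact hconst (exp_mem_ball hv).1
  obtain ⟨A, hA, hA0⟩ := exists_mem_PSU11_apply_eq_zero hG0
  have hAi := isLocalIsometry_of_mem_PSU11 hA
  have hAa : AnalyticAt ℂ A (G 0) :=
    hAi.differentiableOn.analyticAt (isOpen_disc.mem_nhds hG0)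
  refine exists_isLocallyModelledOn_cone_of_eq_exp_mul (γ := 0) le_rfl hσ (hAi.comp hf)
    (G := A ∘ G) (hAa.comp hGa) (fun w hw => ?_) (Or.inr hA0)
  simp [hfG' w hw]

/-- Parabolic monodromy: the metric is modelled on a cusp. The sign of the translation is
forced: it is the order of vanishing of `exp (i f)` at the puncture. -/
theorem isLocallyModelledOn_cusp_of_translation
    (hf : IsLocalIsometry {w | w.re < a} (logDensity ρ) halfPlane halfPlaneDensity f) {s : ℝ}
    (hs : s = 1 ∨ s = -1)
    (hp : ∀ w : ℂ, w.re < a → f (w + 2 * Real.pi * Complex.I) = f w + 2 * Real.pi * s) :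
    IsLocallyModelledOn ρ cuspDensity := by
  have hexp : ∀ w : ℂ, w.re < a → Complex.exp (Complex.I * f (w + 2 * Real.pi * Complex.I)) =
      Complex.exp (Complex.I * f w) := by
    intro w hw
    rw [hp w hw, mul_add, Complex.exp_add]
    have : Complex.exp (Complex.I * (2 * Real.pi * s)) = 1 := by
      rcases hs with rfl | rfl
      · rw [← Complex.exp_two_pi_mul_I]; congr 1; push_cast; ring
      · rw [← inv_inj, inv_one, ← Complex.exp_neg, ← Complex.exp_two_pi_mul_I]
        congr 1; push_cast; ring
    rw [this, mul_one]
  obtain ⟨Q, hQ, hfQ'⟩ := exists_eq_exp_mul_of_quasiperiodic (γ := 0) (C := 1) one_pos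
    (g := fun w => Complex.exp (Complex.I * f w)) (a := a)
    ((hf.differentiableOn.const_mul Complex.I).cexp)
    (fun w hw => by
      have : 0 < (f w).im := (hf w hw).1
      rw [Complex.norm_exp]
      simpa using this.le)
    (fun w hw => by simpa using hexp w hw)
  have hfQ : ∀ w : ℂ, w.re < a → Complex.exp (Complex.I * f w) = Q (Complex.exp w) := by
    intro w hw; simpa using hfQ' w hw
  have h0mem : (0 : ℂ) ∈ Metric.ball (0 : ℂ) (Real.exp a) := Metric.mem_ball_self (Real.exp_pos a)
  have hQa : AnalyticAt ℂ Q 0 := hQ.analyticAt (Metric.isOpen_ball.mem_nhds h0mem)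
  have hne : ¬ ∀ᶠ z in 𝓝 0, Q z = 0 := by
    intro h
    obtain ⟨b, hba, hb⟩ := exists_forall_exp (h.filter_mono nhdsWithin_le_nhds) a
    obtain ⟨w, hw⟩ := nonempty_re_lt b
    have hw : w.re < b := hw
    have := hfQ w (hw.trans_le hba)
    rw [hb w hw] at this
    exact Complex.exp_ne_zero _ this
  obtain ⟨n, Q₁, hQ₁, hQ₁0, hQn⟩ := hQa.exists_eventuallyEq_pow_smul_nonzero_iff.2 hne
  obtain ⟨k, hk, hkQ⟩ := exists_analyticAt_log hQ₁ hQ₁0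
  obtain ⟨b, hba, hb⟩ := exists_forall_exp (((hQn.and hkQ).and
    hk.eventually_analyticAt).filter_mono nhdsWithin_le_nhds) a
  -- `i f - n w - k` takes values in `2πiℤ`, so it is constant.
  have hJ : ∀ w ∈ {w : ℂ | w.re < b}, HasDerivAt
      (fun w => Complex.I * f w - n * w - k (Complex.exp w)) 0 w := by
    intro w hw
    have hw : w.re < b := hw
    obtain ⟨-, h2, -⟩ := hf w (hw.trans_le hba)
    have hka := (hb w hw).2.differentiableAt.hasDerivAt
    have h4 : HasDerivAt (fun w : ℂ => n * w) (n : ℂ) w := by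
      simpa using (hasDerivAt_id w).const_mul (n : ℂ)
    have h3 := ((h2.hasDerivAt.const_mul Complex.I).sub h4).sub
      (hka.comp w (Complex.hasDerivAt_exp w))
    have hE := h3.cexp
    have hE1 : (fun w => Complex.exp (Complex.I * f w - n * w - k (Complex.exp w))) =ᶠ[𝓝 w]
        fun _ => 1 := by
      filter_upwards [(isOpen_re_lt b).mem_nhds hw] with v hv
      have hv : v.re < b := hv
      obtain ⟨⟨e1, e2⟩, -⟩ := hb v hv
      rw [Complex.exp_sub, Complex.exp_sub, hfQ v (hv.trans_le hba), e1, ← e2, sub_zero,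
        smul_eq_mul, ← Complex.exp_nat_mul, mul_div_cancel_left₀ _ (Complex.exp_ne_zero _),
        div_self]
      rw [e2]; exact Complex.exp_ne_zero _
    have h5 := hE.deriv
    have h6 := hE1.deriv_eq
    rw [deriv_const] at h6
    have h7 := h5.symm.trans h6
    have h8 := (mul_eq_zero.1 h7).resolve_left (Complex.exp_ne_zero _)
    exact h8 ▸ h3
  have hsn : s = n := by
    obtain ⟨w, hw⟩ := nonempty_re_lt b
    have hw' : w + 2 * Real.pi * Complex.I ∈ {w : ℂ | w.re < b} := by
      simpa using hw
    have hconst := (convex_re_lt b).norm_image_sub_le_of_norm_hasDerivWithin_le (C := 0)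
      (fun w hw => (hJ w hw).hasDerivWithinAt) (by simp) hw hw'
    rw [zero_mul, norm_le_zero_iff] at hconst
    have hw : w.re < b := hw
    simp only [hp w (hw.trans_le hba), Complex.exp_add, Complex.exp_two_pi_mul_I, mul_one] at hconst
    have h1 : 2 * Real.pi * Complex.I * ((s : ℂ) - n) = 0 := by linear_combination hconst
    have h2 := (mul_eq_zero.1 h1).resolve_left Complex.two_pi_I_ne_zero
    exact_mod_cast sub_eq_zero.1 h2
  have hn1 : n = 1 := by
    rcases hs with rfl | rfl
    · exact_mod_cast hsn.symm
    · have : (0 : ℝ) ≤ n := n.cast_nonneg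
      linarith
  have hder : HasDerivAt (fun z => z * Q₁ z) (Q₁ 0) 0 :=
    ((hasDerivAt_id (0 : ℂ)).mul hQ₁.differentiableAt.hasDerivAt).congr_deriv (by simp)
  have hQe : Q =ᶠ[𝓝 0] fun z => z * Q₁ z := by
    filter_upwards [hQn] with z hz
    simpa [hn1] using hz
  refine isLocallyModelledOn_cusp hf hQa ?_ ?_ hfQ
  · rw [hQe.eq_of_nhds, zero_mul]
  · rw [hQe.deriv_eq, hder.deriv]
    exact hQ₁0

/-- Hyperbolic monodromy does not occur: it would move every point at least by its translation
length, which is impossible when the circles around the puncture become short. -/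
theorem not_hyperbolic_monodromy
    (hf : IsLocalIsometry {w | w.re < a} (logDensity ρ) halfPlane halfPlaneDensity f)
    (hρ : Tendsto (fun z => ρ z * ‖z‖) (𝓝[≠] 0) (𝓝 0)) {μ : ℝ} (hμ : 0 < μ) (hμ1 : μ ≠ 1)
    (hp : ∀ w : ℂ, w.re < a → f (w + 2 * Real.pi * Complex.I) = μ * f w) : False := by
  have hlog : 0 < |Real.log μ| := abs_pos.2 (Real.log_ne_zero_of_pos_of_ne_one hμ hμ1)
  set ε := |Real.log μ| / (4 * Real.pi) with hε
  have hε0 : 0 < ε := by positivity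
  obtain ⟨b, hba, hb⟩ := exists_forall_exp (hρ.eventually_lt_const hε0) a
  have hder : ∀ w ∈ {w : ℂ | w.re < b},
      HasDerivWithinAt (fun w => Complex.log (f w)) (deriv f w / f w) {w : ℂ | w.re < b} w := by
    intro w hw
    obtain ⟨h1, h2, -⟩ := hf w (lt_of_lt_of_le hw hba)
    have h1 : 0 < (f w).im := h1
    exact (h2.hasDerivAt.clog (Or.inr h1.ne')).hasDerivWithinAt
  have hbound : ∀ w ∈ {w : ℂ | w.re < b}, ‖deriv f w / f w‖ ≤ ε := by
    intro w hw
    obtain ⟨h1, -, h3⟩ := hf w (lt_of_lt_of_le hw hba)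
    have h1 : 0 < (f w).im := h1
    have h4 : (f w).im ≤ ‖f w‖ := (le_abs_self _).trans (Complex.abs_im_le_norm _)
    calc ‖deriv f w / f w‖ = 1 / ‖f w‖ * ‖deriv f w‖ := by rw [norm_div]; ring
      _ ≤ 1 / (f w).im * ‖deriv f w‖ := by gcongr
      _ = logDensity ρ w := h3
      _ ≤ ε := (hb w hw).le
  obtain ⟨w, hw⟩ := nonempty_re_lt b
  have hw' : w + 2 * Real.pi * Complex.I ∈ {w : ℂ | w.re < b} := by simpa using hw
  have hle := (convex_re_lt b).norm_image_sub_le_of_norm_hasDerivWithin_le hder hbound hw hw'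
  have hwa : w.re < a := lt_of_lt_of_le hw hba
  have h1 : 0 < (f w).im := (hf w hwa).1
  have hf0 : f w ≠ 0 := fun h => by simp [h] at h1
  rw [hp w hwa, Complex.log_ofReal_mul hμ hf0, add_sub_cancel_right, add_sub_cancel_left,
    Complex.norm_real, Real.norm_eq_abs, hε] at hle
  have h5 : ‖(2 * Real.pi * Complex.I : ℂ)‖ = 2 * Real.pi := by
    simp [abs_of_pos Real.pi_pos]
  rw [h5] at hle
  have h6 : |Real.log μ| / (4 * Real.pi) * (2 * Real.pi) = |Real.log μ| / 2 := by
    field_simp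
    norm_num
  linarith

theorem isLocalIsometry_affine {m : ℝ} (hm : 0 < m) (t : ℝ) :
    IsLocalIsometry halfPlane halfPlaneDensity halfPlane halfPlaneDensity (fun z => m * z + t) := by
  have hs : Real.sqrt m * Real.sqrt m = m := Real.mul_self_sqrt hm.le
  have hs0 : Real.sqrt m ≠ 0 := (Real.sqrt_pos.2 hm).ne'
  refine isLocalIsometry_of_mem_PSL2R ⟨Real.sqrt m, t / Real.sqrt m, 0, (Real.sqrt m)⁻¹, ?_, ?_⟩
  · field_simp; simp
  · have hs' : (Real.sqrt m : ℂ) * Real.sqrt m = m := by exact_mod_cast hs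
    have hs0' : (Real.sqrt m : ℂ) ≠ 0 := by exact_mod_cast hs0
    funext z
    push_cast
    rw [zero_mul, zero_add, div_inv_eq_mul, add_mul, div_mul_cancel₀ _ hs0', ← hs']
    ring

theorem I_mem_halfPlane : Complex.I ∈ halfPlane := by simp [halfPlane]

/-- Monodromy fixing `∞`: it is trivial, a translation, or, after conjugation by a real
translation, a dilation. -/
theorem classification_of_affine_monodromy (hσ : ∀ w : ℂ, w.re < a → 0 < logDensity ρ w)
    (hf : IsLocalIsometry {w | w.re < a} (logDensity ρ) halfPlane halfPlaneDensity f)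
    (hρ : Tendsto (fun z => ρ z * ‖z‖) (𝓝[≠] 0) (𝓝 0)) {μ t : ℝ} (hμ : 0 < μ)
    (hp : ∀ w : ℂ, w.re < a → f (w + 2 * Real.pi * Complex.I) = μ * f w + t) :
    (∃ γ > 0, IsLocallyModelledOn ρ (coneDensity γ)) ∨ IsLocallyModelledOn ρ cuspDensity := by
  rcases eq_or_ne μ 1 with rfl | hμ1
  · rcases eq_or_ne t 0 with rfl | ht
    · refine Or.inl (exists_isLocallyModelledOn_cone_of_rotation hσ
        ((isLocalIsometry_cayley I_mem_halfPlane).comp hf) norm_one fun w hw => ?_)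
      simp [hp w hw]
    · have hm : 0 < 2 * Real.pi / |t| := by positivity
      refine Or.inr (isLocallyModelledOn_cusp_of_translation
        ((isLocalIsometry_affine hm 0).comp hf) (s := t / |t|) ?_ fun w hw => ?_)
      · rcases ht.lt_or_gt with h | h
        · right; rw [abs_of_neg h, div_neg, div_self ht]
        · left; rw [abs_of_pos h, div_self ht]
      · simp only [Function.comp_apply, hp w hw]
        push_cast
        ring
  · refine (not_hyperbolic_monodromy ((isLocalIsometry_affine one_pos (t / (μ - 1))).comp hf) hρ
      hμ hμ1 fun w hw => ?_).elim
    have h1 : (μ : ℂ) - 1 ≠ 0 := by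
      rw [sub_ne_zero]; exact_mod_cast hμ1
    simp only [Function.comp_apply, hp w hw]
    push_cast
    field_simp
    ring

theorem exists_fixedPoint_halfPlane {a b c d : ℝ} (h : a * d - b * c = 1) (hc : c ≠ 0)
    (hΔ : (a + d) ^ 2 - 4 < 0) :
    ∃ z₀ ∈ halfPlane, (a * z₀ + b : ℂ) / (c * z₀ + d) = z₀ := by
  set s := Real.sqrt (4 - (a + d) ^ 2) with hs
  have hs0 : 0 < s := Real.sqrt_pos.2 (by linarith)
  have hs2 : s ^ 2 = 4 - (a + d) ^ 2 := Real.sq_sqrt (by linarith)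
  have hc0 : 0 < |c| := abs_pos.2 hc
  have hcc : |c| ^ 2 = c ^ 2 := sq_abs c
  set z₀ : ℂ := ⟨(a - d) / (2 * c), s / (2 * |c|)⟩ with hz₀
  have hmem : z₀ ∈ halfPlane := by
    show 0 < s / (2 * |c|)
    positivity
  refine ⟨z₀, hmem, ?_⟩
  rw [div_eq_iff (PSL2R_denom_ne_zero h hmem)]
  have e1 : 2 * c * z₀.re = a - d := by
    show 2 * c * ((a - d) / (2 * c)) = a - d
    field_simp
  have e2 : 4 * c ^ 2 * z₀.im ^ 2 = s ^ 2 := by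
    show 4 * c ^ 2 * (s / (2 * |c|)) ^ 2 = s ^ 2
    rw [← hcc]; field_simp; norm_num
  have hc4 : 4 * c ≠ 0 := mul_ne_zero four_ne_zero hc
  apply Complex.ext
  · simp
    apply mul_left_cancel₀ hc4
    linear_combination (-(2 * c * z₀.re - a + d)) * e1 + e2 + hs2 - 4 * h
  · simp
    linear_combination (-z₀.im) * e1

/-- A metric whose circles around the puncture become short is modelled on a cone or a cusp. -/
theorem isLocallyModelledOn_cone_or_cusp (hσ : ∀ w : ℂ, w.re < a → 0 < logDensity ρ w)
    (hf : IsLocalIsometry {w | w.re < a} (logDensity ρ) halfPlane halfPlaneDensity f)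
    (hρ : Tendsto (fun z => ρ z * ‖z‖) (𝓝[≠] 0) (𝓝 0)) :
    (∃ γ > 0, IsLocallyModelledOn ρ (coneDensity γ)) ∨ IsLocallyModelledOn ρ cuspDensity := by
  have hshift : IsLocalIsometry {w : ℂ | w.re < a} (logDensity ρ) {w : ℂ | w.re < a} (logDensity ρ)
      (fun w => w + 2 * Real.pi * Complex.I) := by
    intro w hw
    have hd : HasDerivAt (fun w : ℂ => w + 2 * Real.pi * Complex.I) 1 w :=
      (hasDerivAt_id w).add_const _
    refine ⟨by simpa using hw, hd.differentiableAt, ?_⟩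
    rw [hd.deriv, norm_one, mul_one, logDensity_add_two_pi]
  obtain ⟨L, hL, hLf⟩ := halfPlane_rigidity (isOpen_re_lt a) (convex_re_lt a).isPreconnected
    (nonempty_re_lt a) hσ hf (hf.comp hshift)
  have hLi := isLocalIsometry_of_mem_PSL2R hL
  have hp : ∀ w : ℂ, w.re < a → f (w + 2 * Real.pi * Complex.I) = L (f w) :=
    fun w hw => (hLf w hw).symm
  have hmem : ∀ w : ℂ, w.re < a → f w ∈ halfPlane := fun w hw => (hf w hw).1
  obtain ⟨α, β, c, d, hdet, rfl⟩ := hL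
  rcases eq_or_ne c 0 with rfl | hc
  · have hd : α * d = 1 := by linarith
    have hα : α ≠ 0 := left_ne_zero_of_mul_eq_one hd
    refine classification_of_affine_monodromy hσ hf hρ (μ := α ^ 2) (t := α * β) (by positivity)
      fun w hw => ?_
    have hdc : (α : ℂ) * d = 1 := by exact_mod_cast hd
    have hd0 : (d : ℂ) ≠ 0 := right_ne_zero_of_mul_eq_one hdc
    rw [hp w hw]
    push_cast
    rw [zero_mul, zero_add, div_eq_iff hd0]
    linear_combination (-(α * f w + β)) * hdc
  rcases lt_or_ge ((α + d) ^ 2 - 4) 0 with hΔ | hΔ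
  · obtain ⟨z₀, hz₀, hfix⟩ := exists_fixedPoint_halfPlane hdet hc hΔ
    have hC := isLocalIsometry_cayley hz₀
    have hhalf : IsPreconnected halfPlane := (convex_halfSpace_im_gt 0).isPreconnected
    obtain ⟨u, hu, huE⟩ := eq_rotation_of_isLocalIsometry isOpen_halfPlane hhalf
      (fun w (hw : 0 < w.im) => one_div_pos.2 hw) hC (hC.comp hLi) hz₀ (cayley_self z₀)
      (by rw [Function.comp_apply, hfix, cayley_self])
    refine Or.inl (exists_isLocallyModelledOn_cone_of_rotation hσ (hC.comp hf) hu fun w hw => ?_)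
    rw [Function.comp_apply, hp w hw]
    exact huE _ (hmem w hw)
  · -- A real fixed point `x₀` of the monodromy is moved to `∞`.
    set s := Real.sqrt ((α + d) ^ 2 - 4) with hs
    have hs2 : s ^ 2 = (α + d) ^ 2 - 4 := Real.sq_sqrt hΔ
    set x₀ := (α - d + s) / (2 * c) with hx₀
    have hx : 2 * c * x₀ = α - d + s := by rw [hx₀]; field_simp
    have hfix : c * x₀ ^ 2 + (d - α) * x₀ - β = 0 := by
      have hc4 : 4 * c ≠ 0 := mul_ne_zero four_ne_zero hc
      apply mul_left_cancel₀ hc4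
      linear_combination (2 * c * x₀ + d - α + s) * hx + hs2 + 4 * hdet
    set e := c * x₀ + d with he
    have he0 : e ≠ 0 := by
      intro h0
      have : (1 : ℝ) = 0 := by
        linear_combination (-1) * hdet + (α - c * x₀) * h0 + c * hfix
      exact one_ne_zero this
    have hinv : (fun z : ℂ => ((0 : ℝ) * z + (-1 : ℝ)) / ((1 : ℝ) * z + (-x₀ : ℝ))) ∈ PSL2R :=
      ⟨0, -1, 1, -x₀, by ring, rfl⟩
    refine classification_of_affine_monodromy hσ ((isLocalIsometry_of_mem_PSL2R hinv).comp hf) hρ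
      (μ := e ^ 2) (t := -(c * e)) (by positivity) fun w hw => ?_
    have hz := hmem w hw
    have hD := PSL2R_denom_ne_zero hdet hz
    have hzx : f w + -x₀ ≠ 0 := by
      intro h0
      rw [← sub_eq_add_neg] at h0
      have h1 : 0 < (f w).im := hz
      rw [sub_eq_zero.1 h0] at h1
      simp at h1
    have hec : (e : ℂ) ≠ 0 := by exact_mod_cast he0
    have hfixc : (c * x₀ ^ 2 + (d - α) * x₀ - β : ℂ) = 0 := by exact_mod_cast hfix
    have hdetc : (α * d - β * c : ℂ) = 1 := by exact_mod_cast hdet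
    have hee : (e : ℂ) = c * x₀ + d := by rw [he]; push_cast; rfl
    have key : (α * f w + β) / (c * f w + d) + -x₀ = (f w + -x₀) / ((c * f w + d) * e) := by
      rw [eq_div_iff (mul_ne_zero hD hec), add_mul, ← mul_assoc, div_mul_cancel₀ _ hD, hee]
      linear_combination (f w - x₀) * hdetc + (-(c * f w + d)) * hfixc
    simp only [Function.comp_apply, hp w hw]
    push_cast
    rw [zero_mul, zero_add, one_mul, key, zero_mul, zero_add, one_mul, div_div_eq_mul_div,
      mul_div_assoc', div_add' _ _ _ hzx, div_left_inj' hzx, hee]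
    ring

end Monodromy

/-! ### Growth of the density at a puncture -/

/-- `ρ` grows at the puncture like the density of a cone of angle `2πθ`. -/
def HasConeGrowth (ρ : ℂ → ℝ) (θ : ℝ) : Prop :=
  ∃ l > 0, Tendsto (fun z : ℂ => ρ z * ‖z‖ / ‖z‖ ^ θ) (𝓝[≠] 0) (𝓝 l)

/-- `ρ` grows at the puncture like the density of a cusp. -/
def HasCuspGrowth (ρ : ℂ → ℝ) : Prop :=
  ∃ l > 0, Tendsto (fun z : ℂ => ρ z * ‖z‖ * -Real.log ‖z‖) (𝓝[≠] 0) (𝓝 l)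

section Growth

variable {ρ : ℂ → ℝ} {θ γ : ℝ}

theorem tendsto_norm_rpow_nhdsNE_zero (hθ : 0 < θ) :
    Tendsto (fun z : ℂ => ‖z‖ ^ θ) (𝓝[≠] 0) (𝓝 0) := by
  have hn : Tendsto (fun z : ℂ => ‖z‖) (𝓝[≠] 0) (𝓝 0) :=
    (continuous_norm.tendsto' 0 0 norm_zero).mono_left nhdsWithin_le_nhds
  have := hn.rpow_const (p := θ) (Or.inr hθ.le)
  rwa [Real.zero_rpow hθ.ne'] at this

theorem HasConeGrowth.tendsto_zero (h : HasConeGrowth ρ θ) (hθ : 0 < θ) :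
    Tendsto (fun z => ρ z * ‖z‖) (𝓝[≠] 0) (𝓝 0) := by
  obtain ⟨l, -, hl⟩ := h
  have := hl.mul (tendsto_norm_rpow_nhdsNE_zero hθ)
  rw [mul_zero] at this
  refine this.congr' ?_
  filter_upwards [self_mem_nhdsWithin] with z hz
  exact div_mul_cancel₀ _ (Real.rpow_pos_of_pos (norm_pos_iff.2 hz) θ).ne'

theorem tendsto_log_norm_nhdsNE_zero :
    Tendsto (fun z : ℂ => Real.log ‖z‖) (𝓝[≠] 0) atBot :=
  Real.tendsto_log_nhdsGT_zero.comp tendsto_norm_nhdsNE_zero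

theorem HasCuspGrowth.tendsto_zero (h : HasCuspGrowth ρ) :
    Tendsto (fun z => ρ z * ‖z‖) (𝓝[≠] 0) (𝓝 0) := by
  obtain ⟨l, -, hl⟩ := h
  have hi : Tendsto (fun z : ℂ => (-Real.log ‖z‖)⁻¹) (𝓝[≠] 0) (𝓝 0) :=
    (tendsto_neg_atBot_atTop.comp tendsto_log_norm_nhdsNE_zero).inv_tendsto_atTop
  have := hl.mul hi
  rw [mul_zero] at this
  refine this.congr' ?_
  filter_upwards [tendsto_log_norm_nhdsNE_zero.eventually_lt_atBot 0] with z hz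
  exact mul_inv_cancel_right₀ (neg_pos.2 hz).ne' _

theorem HasConeGrowth.le (h : HasConeGrowth ρ θ) (h' : HasConeGrowth ρ γ) : θ ≤ γ := by
  by_contra! hlt
  obtain ⟨l, hl, ht⟩ := h
  obtain ⟨l', hl', ht'⟩ := h'
  have h1 := ht.mul (tendsto_norm_rpow_nhdsNE_zero (sub_pos.2 hlt))
  rw [mul_zero] at h1
  refine hl'.ne (tendsto_nhds_unique (h1.congr' ?_) ht')
  filter_upwards [self_mem_nhdsWithin] with z hz
  have hz0 : 0 < ‖z‖ := norm_pos_iff.2 hz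
  have := (Real.rpow_pos_of_pos hz0 θ).ne'
  have := (Real.rpow_pos_of_pos hz0 γ).ne'
  rw [Real.rpow_sub hz0]
  field_simp

theorem HasConeGrowth.not_hasCuspGrowth (h : HasConeGrowth ρ θ) (hθ : 0 < θ) :
    ¬ HasCuspGrowth ρ := by
  rintro ⟨l', hl', ht'⟩
  obtain ⟨l, hl, ht⟩ := h
  have h0 : Tendsto (fun z : ℂ => -(Real.log ‖z‖ * ‖z‖ ^ θ)) (𝓝[≠] 0) (𝓝 0) := by
    have := ((tendsto_log_mul_rpow_nhdsGT_zero hθ).comp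
      (tendsto_norm_nhdsNE_zero (E := ℂ))).neg
    rwa [neg_zero] at this
  have h1 := ht.mul h0
  rw [mul_zero] at h1
  refine hl'.ne (tendsto_nhds_unique (h1.congr' ?_) ht')
  filter_upwards [self_mem_nhdsWithin] with z hz
  have hz0 : 0 < ‖z‖ := norm_pos_iff.2 hz
  have := (Real.rpow_pos_of_pos hz0 θ).ne'
  field_simp

theorem tendsto_norm_div_norm {ψ : ℂ → ℂ} (hψ : AnalyticAt ℂ ψ 0) (hψ0 : ψ 0 = 0) :
    Tendsto (fun z : ℂ => ‖ψ z‖ / ‖z‖) (𝓝[≠] 0) (𝓝 ‖deriv ψ 0‖) := by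
  have := (hasDerivAt_iff_tendsto_slope.1 hψ.differentiableAt.hasDerivAt).norm
  refine this.congr fun z => ?_
  simp [slope_def_field, hψ0]

theorem IsLocallyModelledOn.hasConeGrowth (hγ : 0 < γ)
    (h : IsLocallyModelledOn ρ (coneDensity γ)) : HasConeGrowth ρ γ := by
  obtain ⟨ψ, hψ, hψ0, hψ', hρ⟩ := h
  set A := ‖deriv ψ 0‖ with hA_def
  have hA : 0 < A := norm_pos_iff.2 hψ'
  have h1 := tendsto_norm_div_norm hψ hψ0
  have h2 : Tendsto (fun z : ℂ => ‖deriv ψ z‖) (𝓝[≠] 0) (𝓝 A) :=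
    hψ.deriv.continuousAt.norm.tendsto.mono_left nhdsWithin_le_nhds
  have h3 : Tendsto (fun z : ℂ => ‖ψ z‖ ^ γ) (𝓝[≠] 0) (𝓝 0) := by
    have hn : Tendsto (fun z : ℂ => ‖ψ z‖) (𝓝[≠] 0) (𝓝 0) := by
      have := hψ.continuousAt.norm.tendsto.mono_left (nhdsWithin_le_nhds (s := {0}ᶜ))
      rwa [hψ0, norm_zero] at this
    have := hn.rpow_const (p := γ) (Or.inr hγ.le)
    rwa [Real.zero_rpow hγ.ne'] at this
  have h4 : Tendsto (fun z : ℂ => 2 / (1 - (‖ψ z‖ ^ γ) ^ 2)) (𝓝[≠] 0) (𝓝 (2 / (1 - 0 ^ 2))) :=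
    tendsto_const_nhds.div (tendsto_const_nhds.sub (h3.pow 2)) (by norm_num)
  have h5 := ((h4.mul ((h1.rpow_const (p := γ) (Or.inl hA.ne')).const_mul γ)).mul
    (h1.inv₀ hA.ne')).mul h2
  refine ⟨_, ?_, h5.congr' ?_⟩
  · have := Real.rpow_pos_of_pos hA γ
    have : (0 : ℝ) < 2 / (1 - 0 ^ 2) := by norm_num
    positivity
  · filter_upwards [hρ, self_mem_nhdsWithin, h1.eventually_ne hA.ne'] with z hz h0 hψz
    have hz0 : 0 < ‖z‖ := norm_pos_iff.2 h0
    have hψz : ‖ψ z‖ ≠ 0 := fun h => hψz (by simp [h])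
    have := (Real.rpow_pos_of_pos hz0 γ).ne'
    rw [hz, coneDensity, Real.div_rpow (norm_nonneg _) hz0.le]
    field_simp

theorem IsLocallyModelledOn.hasCuspGrowth (h : IsLocallyModelledOn ρ cuspDensity) :
    HasCuspGrowth ρ := by
  obtain ⟨ψ, hψ, hψ0, hψ', hρ⟩ := h
  set A := ‖deriv ψ 0‖ with hA_def
  have hA : 0 < A := norm_pos_iff.2 hψ'
  have h1 := tendsto_norm_div_norm hψ hψ0
  have h2 : Tendsto (fun z : ℂ => ‖deriv ψ z‖) (𝓝[≠] 0) (𝓝 A) :=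
    hψ.deriv.continuousAt.norm.tendsto.mono_left nhdsWithin_le_nhds
  -- `log ‖ψ z‖ / log ‖z‖ = log (‖ψ z‖ / ‖z‖) / log ‖z‖ + 1` tends to `1`.
  have h3 : Tendsto (fun z : ℂ => Real.log (‖ψ z‖ / ‖z‖) * (Real.log ‖z‖)⁻¹ + 1) (𝓝[≠] 0)
      (𝓝 (Real.log A * 0 + 1)) :=
    ((h1.log hA.ne').mul tendsto_log_norm_nhdsNE_zero.inv_tendsto_atBot).add_const 1
  have h4 := ((h3.inv₀ (by norm_num)).mul (h1.inv₀ hA.ne')).mul h2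
  refine ⟨_, ?_, h4.congr' ?_⟩
  · rw [mul_zero, zero_add, inv_one, one_mul]
    positivity
  · filter_upwards [hρ, self_mem_nhdsWithin, h1.eventually_ne hA.ne',
      tendsto_log_norm_nhdsNE_zero.eventually_lt_atBot 0] with z hz h0 hψz hlog
    have hz0 : 0 < ‖z‖ := norm_pos_iff.2 h0
    have hψz : ‖ψ z‖ ≠ 0 := fun h => hψz (by simp [h])
    have hl : Real.log (‖ψ z‖ / ‖z‖) * (Real.log ‖z‖)⁻¹ + 1 =
        Real.log ‖ψ z‖ / Real.log ‖z‖ := by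
      rw [Real.log_div hψz hz0.ne']
      field_simp [hlog.ne]
      ring
    rw [hl, hz, cuspDensity, inv_div, inv_div]
    ring

end Growth

/-! ### Branches of the developing map at a puncture -/

section Surface

theorem symm_exp_mem {X : Type*} [TopologicalSpace X] {e : OpenPartialHomeomorph X ℂ} {p : X}
    {r : ℝ} (hep : e p = 0) (hr : 0 < r)
    (hball : Metric.ball 0 r ⊆ e.target) {w : ℂ} (hw : w.re < Real.log r) :
    Complex.exp w ∈ e.target \ {0} ∧ e.symm (Complex.exp w) ∈ e.source \ {p} := by
  have h1 := exp_mem_ball hw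
  rw [Real.exp_log hr] at h1
  have h2 : Complex.exp w ∈ e.target := hball h1.1
  refine ⟨⟨h2, h1.2⟩, e.map_target h2, fun h => h1.2 ?_⟩
  rw [mem_singleton_iff] at h ⊢
  rw [← e.right_inv h2, h, hep]

/-- A branch over a punctured disc is continued along all paths: the uniformization of the
punctured disc by the logarithm lifts to the universal covering. -/
theorem IsUniversalCovering.exists_lift {X E : Type*} [TopologicalSpace X] [TopologicalSpace E]
    {W : Set X} {π : E → X} {e : OpenPartialHomeomorph X ℂ} {p : X} {r : ℝ}
    (hπ : IsUniversalCovering W π) (hep : e p = 0) (hW : e.source \ {p} ⊆ W)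
    (hr : 0 < r) (hball : Metric.ball 0 r ⊆ e.target)
    {x₀ : E} {w₀ : ℂ} (hw₀ : w₀.re < Real.log r) (hx₀ : π x₀ = e.symm (Complex.exp w₀)) :
    ∃ φ : ℂ → E, ContinuousOn φ {w | w.re < Real.log r} ∧ φ w₀ = x₀ ∧
      ∀ w : ℂ, w.re < Real.log r → π (φ w) = e.symm (Complex.exp w) := by
  classical
  set H : Set ℂ := {w | w.re < Real.log r}
  have : ContractibleSpace H := (convex_re_lt _).contractibleSpace (nonempty_re_lt _)
  have : LocallyPathConnectedSpace H := (isOpen_re_lt _).locallyPathConnectedSpace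
  have hmem : ∀ w : H, e.symm (Complex.exp w) ∈ W := fun w =>
    hW (symm_exp_mem hep hr hball w.2).2
  have hc : Continuous fun w : H => e.symm (Complex.exp w) := by
    refine e.continuousOn_symm.comp_continuous
      (Complex.continuous_exp.comp continuous_subtype_val) fun w => ?_
    exact (symm_exp_mem hep hr hball w.2).1.1
  obtain ⟨Φ, ⟨hΦ0, hΦ⟩, -⟩ := hπ.isCoveringMapOn.existsUnique_continuousMap_lifts
    (⟨_, hc⟩ : C(H, X)) (a₀ := ⟨w₀, hw₀⟩) (e₀ := x₀) hx₀ hmem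
  refine ⟨fun w => if hw : w ∈ H then Φ ⟨w, hw⟩ else x₀, ?_, ?_, ?_⟩
  · rw [continuousOn_iff_continuous_domRestrict]
    convert Φ.continuous using 1
    funext w
    exact dif_pos w.2
  · exact (dif_pos (show w₀ ∈ H from hw₀)).trans hΦ0
  · intro w hw
    exact (congrArg π (dif_pos (show w ∈ H from hw))).trans (congrFun hΦ ⟨w, hw⟩)

variable {X : Type*} [TopologicalSpace X] [ChartedSpace ℂ X] {W : Set X}
  {E : Type*} [TopologicalSpace E] {π : E → X} {e : OpenPartialHomeomorph X ℂ} {p : X} {r : ℝ}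

theorem ConformalMetric.logDensity_pos (m : ConformalMetric W) (he : e ∈ coordinates X)
    (hep : e p = 0) (hW : e.source \ {p} ⊆ W) (hr : 0 < r) (hball : Metric.ball 0 r ⊆ e.target)
    {w : ℂ} (hw : w.re < Real.log r) : 0 < logDensity (m.density e) w := by
  obtain ⟨h1, h2⟩ := symm_exp_mem hep hr hball hw
  have := m.density_pos e he _ ⟨h2.1, hW h2⟩
  rw [e.right_inv h1.1] at this
  exact mul_pos this (norm_pos_iff.2 (Complex.exp_ne_zero w))

/-- The continued branch of a developing map, as a function of the logarithm of the coordinate, is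
a local isometry. -/
theorem IsDevelopingMap.isLocalIsometry {m : ConformalMetric W} {Ω : Set ℂ} {ρ : ℂ → ℝ} {F : E → ℂ}
    (hF : IsDevelopingMap m π Ω ρ F) (he : e ∈ coordinates X) (hr : 0 < r)
    (hball : Metric.ball 0 r ⊆ e.target) {φ : ℂ → E}
    (hφ : ContinuousOn φ {w | w.re < Real.log r})
    (hπφ : ∀ w : ℂ, w.re < Real.log r → π (φ w) = e.symm (Complex.exp w)) :
    IsLocalIsometry {w | w.re < Real.log r} (logDensity (m.density e)) Ω ρ (F ∘ φ) := by
  intro w hw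
  set z₀ := Complex.exp w with hz₀
  have h0 : z₀ ≠ 0 := Complex.exp_ne_zero w
  have hz₀b := exp_mem_ball hw
  rw [Real.exp_log hr] at hz₀b
  -- The branch of the logarithm near `z₀` that takes the value `w` there.
  set l : ℂ → ℂ := fun z => w + Complex.log (z / z₀) with hl
  set V : Set ℂ := Metric.ball 0 r ∩ (fun z => z / z₀) ⁻¹' Complex.slitPlane with hV
  have hdivc : Continuous fun z : ℂ => z / z₀ := continuous_id.div_const z₀
  have hVo : IsOpen V := Metric.isOpen_ball.inter (Complex.isOpen_slitPlane.preimage hdivc)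
  have hz₀V : z₀ ∈ V := ⟨hz₀b.1, by simp [div_self h0]⟩
  have hexp : ∀ z ∈ V, Complex.exp (l z) = z := by
    intro z hz
    rw [hl, Complex.exp_add, Complex.exp_log (Complex.slitPlane_ne_zero hz.2), ← hz₀,
      mul_div_cancel₀ _ h0]
  have hre : ∀ z ∈ V, (l z).re < Real.log r := by
    intro z hz
    have h1 : ‖z‖ < r := by simpa using hz.1
    rw [← hexp z hz, Complex.norm_exp] at h1
    rwa [Real.lt_log_iff_exp_lt hr]
  have hlc : ContinuousOn l V :=
    continuousOn_const.add (ContinuousOn.clog hdivc.continuousOn fun z hz => hz.2)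
  have hs : IsLocalSection π e V (φ ∘ l) := by
    refine ⟨hVo, inter_subset_left.trans hball, hφ.comp hlc hre, fun z hz => ?_⟩
    rw [Function.comp_apply, hπφ _ (hre z hz), hexp z hz]
  have hlw : l z₀ = w := by simp [hl, div_self h0]
  -- Near `w` the branch is the function element composed with `exp`.
  have heq : F ∘ φ =ᶠ[𝓝 w] (F ∘ (φ ∘ l)) ∘ Complex.exp := by
    have hev : ∀ᶠ v in 𝓝 w, (v - w).im ∈ Ioo (-Real.pi) Real.pi := by
      refine ContinuousAt.eventually_mem (by fun_prop) ?_
      rw [sub_self]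
      exact Ioo_mem_nhds (by simp [Real.pi_pos]) (by simp [Real.pi_pos])
    filter_upwards [hev] with v hv
    have : l (Complex.exp v) = v := by
      simp only [hl, hz₀]
      rw [← Complex.exp_sub, Complex.log_exp hv.1 hv.2.le]
      ring
    simp [this]
  have hd1 : DifferentiableAt ℂ (F ∘ (φ ∘ l)) z₀ :=
    (hF.isProjective.holomorphic e he V _ hs).differentiableAt (hVo.mem_nhds hz₀V)
  have hd2 : DifferentiableAt ℂ Complex.exp w := Complex.differentiableAt_exp
  refine ⟨hF.mapsTo _, (hd1.comp w hd2).congr_of_eventuallyEq heq, ?_⟩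
  have hpb := hF.pullback e he V _ hs z₀ hz₀V
  rw [heq.deriv_eq, deriv_comp w hd1 hd2, Complex.deriv_exp, norm_mul, logDensity, ← hz₀, hpb,
    Function.comp_apply, Function.comp_apply, hlw, mul_assoc]

/-- If the metric is, in the coordinate `e`, the metric pulled back by a model map `g`, then every
branch of the developing map is `g` up to an isometry of the model. -/
theorem hasLocalForm_of_density {m : ConformalMetric W} {Ω : Set ℂ} {ρ : ℂ → ℝ} {F : E → ℂ}
    {Γ : Set (ℂ → ℂ)} {g : ℂ → ℂ} {μ : ℂ → ℝ} (hπ : IsUniversalCovering W π)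
    (hF : IsDevelopingMap m π Ω ρ F) (he : e ∈ coordinates X) (hep : e p = 0)
    (hW : e.source \ {p} ⊆ W) (hr : 0 < r) (ht : e.target = Metric.ball 0 r)
    (hμ : ∀ w : ℂ, w.re < Real.log r → logDensity (m.density e) w = logDensity μ w)
    (hg : IsLocalIsometry {w | w.re < Real.log r} (logDensity μ) Ω ρ g)
    (hΓ : ∀ {U : Set ℂ} {σ : ℂ → ℝ} {f g : ℂ → ℂ}, IsOpen U → IsPreconnected U → U.Nonempty →
      (∀ w ∈ U, 0 < σ w) → IsLocalIsometry U σ Ω ρ f → IsLocalIsometry U σ Ω ρ g →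
      ∃ L ∈ Γ, ∀ w ∈ U, L (f w) = g w) :
    HasLocalForm π F Γ e r g := by
  intro x₀ w₀ hw₀ hx₀
  obtain ⟨φ, hφc, hφ0, hφπ⟩ := hπ.exists_lift hep hW hr ht.ge hw₀ hx₀
  have hφ := hF.isLocalIsometry he hr ht.ge hφc hφπ
  obtain ⟨L, hL, hLE⟩ := hΓ (isOpen_re_lt _) (convex_re_lt _).isPreconnected (nonempty_re_lt _)
    (fun w hw => m.logDensity_pos he hep hW hr ht.ge hw) hφ
    (fun w hw => ⟨(hg w hw).1, (hg w hw).2.1, (hg w hw).2.2.trans (hμ w hw).symm⟩)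
  exact ⟨φ, hφc, hφ0, hφπ, L, hL, hLE⟩

/-! ### Changing the coordinate at a puncture -/

/-- A local biholomorphism `ψ` fixing `0` turns a coordinate centred at `p` into another one, which
can be restricted so as to map onto a small disc. -/
theorem exists_coordinate_comp [IsManifold 𝓘(ℂ) ω X] (he : e ∈ coordinates X) (hp : p ∈ e.source)
    (hep : e p = 0) {ψ : ℂ → ℂ} (hψ : AnalyticAt ℂ ψ 0) (hψ0 : ψ 0 = 0) (hψ' : deriv ψ 0 ≠ 0)
    {N : Set ℂ} (hN : N ∈ 𝓝 0) {R : ℝ} (hR : 0 < R) :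
    ∃ z ∈ coordinates X, p ∈ z.source ∧ z.source ⊆ e.source ∧
      (∀ x ∈ z.source, e x ∈ N ∧ z x = ψ (e x) ∧ deriv (z ∘ e.symm) (e x) = deriv ψ (e x) ∧
        deriv ψ (e x) ≠ 0) ∧
      ∃ r > 0, r ≤ R ∧ z.target = Metric.ball 0 r := by
  obtain ⟨Ψ, hΨ, h0Ψ, hΨN, hΨd, hΨs⟩ := exists_openPartialHomeomorph_of_deriv_ne_zero hψ hψ'
    (inter_mem hN (e.open_target.mem_nhds (hep ▸ e.map_source hp)))
  have h0t : (0 : ℂ) ∈ Ψ.target := by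
    have := Ψ.map_source h0Ψ
    rwa [hΨ, hψ0] at this
  obtain ⟨r', hr', hball'⟩ := Metric.isOpen_iff.1 Ψ.open_target 0 h0t
  set r := min r' R with hr_def
  have hr : 0 < r := lt_min hr' hR
  have hball : Metric.ball (0 : ℂ) r ⊆ Ψ.target :=
    (Metric.ball_subset_ball (min_le_left _ _)).trans hball'
  set z := (e.trans Ψ).trans (OpenPartialHomeomorph.ofSet (Metric.ball 0 r) Metric.isOpen_ball)
    with hz
  have hzx : ∀ x, z x = ψ (e x) := fun x => by simp [hz, hΨ]
  have hzs : ∀ ζ, z.symm ζ = e.symm (Ψ.symm ζ) := fun x => by simp [hz]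
  have hsrc : ∀ x, x ∈ z.source ↔ x ∈ e.source ∧ e x ∈ Ψ.source ∧ ψ (e x) ∈ Metric.ball 0 r := by
    intro x
    simp [hz, hΨ, and_assoc]
  have htgt : z.target = Metric.ball 0 r := by
    ext ζ
    have : ζ ∈ Metric.ball (0 : ℂ) r → Ψ.symm ζ ∈ e.target := fun h =>
      (hΨN (Ψ.map_target (hball h))).2
    have h3 := @hball ζ
    simp only [hz, OpenPartialHomeomorph.trans_target, OpenPartialHomeomorph.ofSet_target,
      OpenPartialHomeomorph.ofSet_symm, OpenPartialHomeomorph.ofSet_apply, mem_inter_iff,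
      mem_preimage, id]
    tauto
  refine ⟨z, ?_, ?_, fun x hx => ((hsrc x).1 hx).1, ?_, r, hr, min_le_right _ _, htgt⟩
  · apply OpenPartialHomeomorph.mem_maximalAtlas_of_contMDiffOn
    · have h1 : ContMDiffOn 𝓘(ℂ) 𝓘(ℂ) ω ψ Ψ.source := by
        rw [contMDiffOn_iff_contDiffOn]
        exact fun y hy => (hΨd y hy).1.contDiffAt.contDiffWithinAt
      have h2 := contMDiffOn_of_mem_maximalAtlas (I := 𝓘(ℂ)) (n := ω) he
      refine (h1.comp (h2.mono fun x hx => ((hsrc x).1 hx).1)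
        fun x hx => ((hsrc x).1 hx).2.1).congr fun x _ => hzx x
    · rw [htgt]
      have h1 : ContMDiffOn 𝓘(ℂ) 𝓘(ℂ) ω Ψ.symm (Metric.ball 0 r) := by
        rw [contMDiffOn_iff_contDiffOn]
        exact fun y hy => (hΨs y (hball hy)).contDiffAt.contDiffWithinAt
      have h2 := contMDiffOn_symm_of_mem_maximalAtlas (I := 𝓘(ℂ)) (n := ω) he
      exact (h2.comp h1 fun y hy => (hΨN (Ψ.map_target (hball hy))).2).congr fun y _ => hzs y
  · rw [hsrc, hep, hψ0]
    exact ⟨hp, h0Ψ, Metric.mem_ball_self hr⟩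
  · intro x hx
    obtain ⟨h1, h2, -⟩ := (hsrc x).1 hx
    refine ⟨(hΨN h2).1, hzx x, ?_, (hΨd _ h2).2⟩
    refine Filter.EventuallyEq.deriv_eq ?_
    filter_upwards [e.open_target.mem_nhds (e.map_source h1)] with y hy
    rw [Function.comp_apply, hzx, e.right_inv hy]

theorem ConformalMetric.exists_coordinate_of_isLocallyModelledOn [IsManifold 𝓘(ℂ) ω X]
    (m : ConformalMetric W) (he : e ∈ coordinates X) (hp : p ∈ e.source) (hep : e p = 0)
    (hW : e.source \ {p} ⊆ W) {μ : ℂ → ℝ} (hμ : IsLocallyModelledOn (m.density e) μ) :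
    ∃ z ∈ coordinates X, p ∈ z.source ∧ z p = 0 ∧ z.source \ {p} ⊆ W ∧
      ∃ r > 0, r ≤ 1 ∧ z.target = Metric.ball 0 r ∧
        ∀ w : ℂ, w.re < Real.log r → logDensity (m.density z) w = logDensity μ w := by
  obtain ⟨ψ, hψ, hψ0, hψ', hρ⟩ := hμ
  obtain ⟨z, hz, hpz, hze, hzx, r, hr, hr1, ht⟩ := exists_coordinate_comp he hp hep hψ hψ0 hψ'
    (eventually_nhdsWithin_iff.1 hρ) one_pos
  have hzp : z p = 0 := by rw [(hzx p hpz).2.1, hep, hψ0]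
  refine ⟨z, hz, hpz, hzp, fun x hx => hW ⟨hze hx.1, hx.2⟩, r, hr, hr1, ht, fun w hw => ?_⟩
  obtain ⟨h1, h2⟩ := symm_exp_mem hzp hr ht.ge hw
  set x := z.symm (Complex.exp w)
  have hzw : z x = Complex.exp w := z.right_inv h1.1
  obtain ⟨k1, k2, k3, k4⟩ := hzx x h2.1
  have hex : e x ≠ 0 := fun h => h1.2 (by rw [mem_singleton_iff, ← hzw, k2, h, hψ0])
  have hch := m.density_change e he z hz x ⟨⟨hze h2.1, h2.1⟩, hW ⟨hze h2.1, h2.2⟩⟩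
  have hm : m.density e (e x) = μ (ψ (e x)) * ‖deriv ψ (e x)‖ := k1 hex
  rw [hm, k3, ← k2, hzw] at hch
  rw [logDensity, logDensity, mul_right_cancel₀ (norm_ne_zero_iff.2 k4) hch]

/-! ### The local form at a singularity -/

theorem exists_isLocalIsometry_branch {m : ConformalMetric W} {Ω : Set ℂ} {ρ : ℂ → ℝ} {F : E → ℂ}
    (hπ : IsUniversalCovering W π) (hF : IsDevelopingMap m π Ω ρ F) (he : e ∈ coordinates X)
    (hep : e p = 0) (hW : e.source \ {p} ⊆ W) (hr : 0 < r)
    (hball : Metric.ball 0 r ⊆ e.target) :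
    ∃ f : ℂ → ℂ, IsLocalIsometry {w | w.re < Real.log r} (logDensity (m.density e)) Ω ρ f := by
  obtain ⟨w₀, hw₀⟩ := nonempty_re_lt (Real.log r)
  have hmem : e.symm (Complex.exp w₀) ∈ range π := by
    rw [hπ.range_eq]
    exact hW (symm_exp_mem hep hr hball hw₀).2
  obtain ⟨x₀, hx₀⟩ := hmem
  obtain ⟨φ, hφc, -, hφπ⟩ := hπ.exists_lift hep hW hr hball hw₀ hx₀
  exact ⟨F ∘ φ, hF.isLocalIsometry he hr hball hφc hφπ⟩

theorem ConformalMetric.density_pos_of_mem_target (m : ConformalMetric W) (he : e ∈ coordinates X)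
    (hep : e p = 0) (hW : e.source \ {p} ⊆ W) {z : ℂ} (hz : z ∈ e.target \ {0}) :
    0 < m.density e z := by
  have hne : e.symm z ≠ p := fun h => hz.2 (by rw [mem_singleton_iff, ← e.right_inv hz.1, h, hep])
  have := m.density_pos e he (e.symm z) ⟨e.map_target hz.1, hW ⟨e.map_target hz.1, hne⟩⟩
  rwa [e.right_inv hz.1] at this

theorem ConformalMetric.HasConicalSingularity.exists_hasConeGrowth {m : ConformalMetric W} {θ : ℝ}
    (h : m.HasConicalSingularity p θ) :
    ∃ e ∈ coordinates X, p ∈ e.source ∧ e p = 0 ∧ e.source \ {p} ⊆ W ∧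
      HasConeGrowth (m.density e) θ := by
  obtain ⟨-, e, he, hp, hep, hW, c, hc, hcE⟩ := h
  have h0 : e.target ∈ 𝓝 (0 : ℂ) := e.open_target.mem_nhds (hep ▸ e.map_source hp)
  refine ⟨e, he, hp, hep, hW, Real.exp (c 0), Real.exp_pos _, ?_⟩
  refine ((hc.continuousAt h0).rexp.tendsto.mono_left nhdsWithin_le_nhds).congr' ?_
  filter_upwards [self_mem_nhdsWithin, mem_nhdsWithin_of_mem_nhds h0] with z hz hzt
  have hz0 : 0 < ‖z‖ := norm_pos_iff.2 hz
  have hρ := m.density_pos_of_mem_target he hep hW ⟨hzt, hz⟩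
  rw [← hcE z ⟨hzt, hz⟩, Real.exp_sub, Real.exp_log hρ, mul_comm (θ - 1),
    ← Real.rpow_def_of_pos hz0, Real.rpow_sub hz0, Real.rpow_one, div_div_eq_mul_div]

theorem ConformalMetric.HasCuspSingularity.exists_hasCuspGrowth {m : ConformalMetric W}
    (h : m.HasCuspSingularity p) :
    ∃ e ∈ coordinates X, p ∈ e.source ∧ e p = 0 ∧ e.source \ {p} ⊆ W ∧
      HasCuspGrowth (m.density e) := by
  obtain ⟨e, he, hp, hep, hW, hball, c, hc, hcE⟩ := h
  have h0 : e.target ∈ 𝓝 (0 : ℂ) := e.open_target.mem_nhds (hep ▸ e.map_source hp)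
  refine ⟨e, he, hp, hep, hW, Real.exp (c 0), Real.exp_pos _, ?_⟩
  refine ((hc.continuousAt h0).rexp.tendsto.mono_left nhdsWithin_le_nhds).congr' ?_
  filter_upwards [self_mem_nhdsWithin, mem_nhdsWithin_of_mem_nhds h0] with z hz hzt
  have hz0 : 0 < ‖z‖ := norm_pos_iff.2 hz
  have hz1 : ‖z‖ < 1 := by simpa using hball hzt
  have hρ := m.density_pos_of_mem_target he hep hW ⟨hzt, hz⟩
  rw [← hcE z ⟨hzt, hz⟩, Real.exp_add, Real.exp_add, Real.exp_log hρ, Real.exp_log hz0,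
    Real.exp_log (neg_pos.2 (Real.log_neg hz0 hz1))]

end Surface

theorem theorem1p3 {X : Type*} [TopologicalSpace X] [T2Space X] [ConnectedSpace X]
    [ChartedSpace ℂ X] [IsManifold 𝓘(ℂ) ω X]
    (D : Function.locallyFinsupp X ℝ) (m : ConformalMetric (D.support)ᶜ) (hm : m.Represents D)
    {E : Type*} [TopologicalSpace E] (π : E → X) (hπ : IsUniversalCovering (D.support)ᶜ π) :
    (∀ F : E → ℂ, IsDevelopingMap m π disc discDensity F →
      ∀ p ∈ D.support, 0 < D p + 1 →
        ∃ z ∈ coordinates X, p ∈ z.source ∧ z p = 0 ∧ z.source \ {p} ⊆ (D.support)ᶜ ∧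
          ∃ r > 0, z.target = Metric.ball 0 r ∧
            HasLocalForm π F PSU11 z r (fun w => Complex.exp ((D p + 1 : ℝ) * w))) ∧
    (∀ F : E → ℂ, IsDevelopingMap m π halfPlane halfPlaneDensity F →
      ∀ q ∈ D.support, D q + 1 = 0 →
        ∃ z ∈ coordinates X, q ∈ z.source ∧ z q = 0 ∧ z.source \ {q} ⊆ (D.support)ᶜ ∧
          ∃ r > 0, z.target = Metric.ball 0 r ∧
            HasLocalForm π F PSL2R z r (fun w => -Complex.I * w)) := by
  constructor
  · intro F hF p hp hθ
    obtain ⟨e, he, hpe, hep, hW, hgrowth⟩ := ((hm.2 p hp).2.1 hθ).exists_hasConeGrowth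
    obtain ⟨R, hR, hball⟩ := Metric.isOpen_iff.1 e.open_target 0 (hep ▸ e.map_source hpe)
    obtain ⟨f, hf⟩ := exists_isLocalIsometry_branch hπ hF he hep hW hR hball
    have hmodel : IsLocallyModelledOn (m.density e) (coneDensity (D p + 1)) := by
      rcases isLocallyModelledOn_cone_or_cusp
        (fun _ hw => m.logDensity_pos he hep hW hR hball hw)
        (isLocalIsometry_inverseCayley.comp hf) (hgrowth.tendsto_zero hθ) with ⟨γ, hγ, h⟩ | h
      · rwa [le_antisymm (hgrowth.le (h.hasConeGrowth hγ)) ((h.hasConeGrowth hγ).le hgrowth)]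
      · exact absurd h.hasCuspGrowth (hgrowth.not_hasCuspGrowth hθ)
    obtain ⟨z, hz, hpz, hzp, hzW, r, hr, hr1, ht, hμ⟩ :=
      m.exists_coordinate_of_isLocallyModelledOn he hpe hep hW hmodel
    refine ⟨z, hz, hpz, hzp, hzW, r, hr, ht, hasLocalForm_of_density hπ hF hz hzp hzW hr ht hμ
      ((isLocalIsometry_exp_mul hθ).mono fun w hw => ?_) disc_rigidity⟩
    exact lt_of_lt_of_le hw (Real.log_nonpos hr.le hr1)
  · intro F hF q hq hθ
    obtain ⟨e, he, hqe, heq, hW, hgrowth⟩ := ((hm.2 q hq).2.2 hθ).exists_hasCuspGrowth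
    obtain ⟨R, hR, hball⟩ := Metric.isOpen_iff.1 e.open_target 0 (heq ▸ e.map_source hqe)
    obtain ⟨f, hf⟩ := exists_isLocalIsometry_branch hπ hF he heq hW hR hball
    have hmodel : IsLocallyModelledOn (m.density e) cuspDensity := by
      rcases isLocallyModelledOn_cone_or_cusp
        (fun _ hw => m.logDensity_pos he heq hW hR hball hw) hf hgrowth.tendsto_zero with
        ⟨γ, hγ, h⟩ | h
      · exact absurd hgrowth ((h.hasConeGrowth hγ).not_hasCuspGrowth hγ)
      · exact h
    obtain ⟨z, hz, hqz, hzq, hzW, r, hr, hr1, ht, hμ⟩ :=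
      m.exists_coordinate_of_isLocallyModelledOn he hqe heq hW hmodel
    refine ⟨z, hz, hqz, hzq, hzW, r, hr, ht, hasLocalForm_of_density hπ hF hz hzq hzW hr ht hμ
      (isLocalIsometry_neg_I_mul.mono fun w hw => ?_) halfPlane_rigidity⟩
    exact lt_of_lt_of_le hw (Real.log_nonpos hr.le hr1)
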